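/- \textbf{Theorem.} The following is provable in $\mathsf{RCA}_0$: if the discrete order $\mathbf 3$ with underlying set $\{0,1,2\}$ is $\Delta^0_2\text{-}\mathsf{BQO}$, then $\Omega\oplus\Omega$ is $\Delta^0_2\text{-}\mathsf{BQO}$ for every well order $\Omega$. Equivalently (by Gödel's completeness theorem), for every model $(M,S)$ of $\mathsf{RCA}_0$, where the number variables range over a possibly nonstandard $M$ and the set variables over a collection $S$ of subsets of $M$: if $(M,S)$ satisfies that $\mathbf 3$ is $\Delta^0_2\text{-}\mathsf{BQO}$, then it satisfies that $\Omega\oplus\Omega$ is $\Delta^0_2\text{-}\mathsf{BQO}$ for every $\Omega$ in $S$ that is a well order in the sense of $(M,S)$. Here $\mathsf{RCA}_0$ is the usual base theory of reverse mathematics in the language of second order arithmetic (basic axioms of arithmetic, $\Sigma^0_1$-induction and $\Delta^0_1$-comprehension, with number and set parameters). A well order is a linear order on a set of natural numbers that admits no strictly descending sequence $\mathbb N\to\Omega$. The order $\Omega\oplus\Omega$ consists of the pairs $\langle i,\alpha\rangle$ with $i\in\{0,1\}$ and $\alpha\in\Omega$, with $\langle i,\alpha\rangle\le\langle j,\beta\rangle$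 if and only if $i=j$ and $\alpha\le_\Omega\beta$. We write $[\mathbb N]^\omega$ for the collection of infinite subsets of $\mathbb N$, and $X^-=X\setminus\{\min X\}$ for $X\in[\mathbb N]^\omega$. A function $F:[\mathbb N]^\omega\to Q$ into a quasi order $Q$ is bad if there is no $X\in[\mathbb N]^\omega$ with $F(X)\le_Q F(X^-)$. It is a $\Delta^0_2$-function if the relation $F(X)=q$ is defined by a $\Sigma^0_2$-formula, possibly with number and set parameters. The quasi order $Q$ is $\Delta^0_2\text{-}\mathsf{BQO}$ if there is no bad $\Delta^0_2$-function $F:[\mathbb N]^\omega\to Q$. -/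

import Mathlib

universe u

namespace RevMath

/-! ## Second order arithmetic and the theory `RCA₀`

A structure for the language of second order arithmetic consists of a type `M` of numbers with
`0, 1, +, ·, <` (possibly nonstandard) and a collection `S` of subsets of `M`, over which the set
variables range. -/

/-- The number part of a structure for the language of second order arithmetic.  No laws are
assumed here; they are axioms of `RCA₀`. -/
class L2 (M : Type u) extends Zero M, One M, Add M, Mul M, LT M

/-- Numerical terms in the number variables `x₀, …, xₙ₋₁`. -/
inductive NumTerm (n : ℕ) : Type
  | var (i : Fin n) : NumTerm n
  | zero : NumTerm n
  | one : NumTerm n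
  | add (s t : NumTerm n) : NumTerm n
  | mul (s t : NumTerm n) : NumTerm n

/-- The value of a term under an assignment. -/
def NumTerm.val {M : Type u} [L2 M] {n : ℕ} (v : Fin n → M) : NumTerm n → M
  | .var i => v i
  | .zero => 0
  | .one => 1
  | .add s t => s.val v + t.val v
  | .mul s t => s.val v * t.val v

/-- Bounded quantifier formulas with set variables `X₀, …, Xₖ₋₁` and number variables
`x₀, …, xₙ₋₁`.  The other connectives and the bounded existential quantifier are definable from
the given ones.  The quantifier `ball t φ` is `∀ x < t, φ`, where `x` does not occur in `t` and
becomes the variable number `0` of `φ`, all other number variables being shifted by one. -/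
inductive BddFormula (k : ℕ) : ℕ → Type
  | eq {n : ℕ} (s t : NumTerm n) : BddFormula k n
  | lt {n : ℕ} (s t : NumTerm n) : BddFormula k n
  | mem {n : ℕ} (t : NumTerm n) (i : Fin k) : BddFormula k n
  | neg {n : ℕ} (φ : BddFormula k n) : BddFormula k n
  | and {n : ℕ} (φ ψ : BddFormula k n) : BddFormula k n
  | ball {n : ℕ} (t : NumTerm n) (φ : BddFormula k (n + 1)) : BddFormula k n

/-- Truth of a bounded quantifier formula under an assignment `V` of the set variables and an
assignment `v` of the number variables. -/
def BddFormula.Holds {M : Type u} [L2 M] {k : ℕ} (V : Fin k → Set M) :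
    {n : ℕ} → (Fin n → M) → BddFormula k n → Prop
  | _, v, .eq s t => s.val v = t.val v
  | _, v, .lt s t => s.val v < t.val v
  | _, v, .mem t i => t.val v ∈ V i
  | _, v, .neg φ => ¬ φ.Holds V v
  | _, v, .and φ ψ => φ.Holds V v ∧ ψ.Holds V v
  | _, v, .ball t φ => ∀ x : M, x < t.val v → φ.Holds V (Matrix.vecCons x v)

/-- Truth of the `Σ⁰₁`-formula `∃ x, θ`. -/
def Sigma1 {M : Type u} [L2 M] {k n : ℕ} (V : Fin k → Set M) (v : Fin n → M)
    (θ : BddFormula k (n + 1)) : Prop :=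
  ∃ x : M, θ.Holds V (Matrix.vecCons x v)

/-- Truth of the `Π⁰₁`-formula `∀ x, θ`. -/
def Pi1 {M : Type u} [L2 M] {k n : ℕ} (V : Fin k → Set M) (v : Fin n → M)
    (θ : BddFormula k (n + 1)) : Prop :=
  ∀ x : M, θ.Holds V (Matrix.vecCons x v)

/-- Truth of the `Σ⁰₂`-formula `∃ x, ∀ y, θ`. -/
def Sigma2 {M : Type u} [L2 M] {k n : ℕ} (V : Fin k → Set M) (v : Fin n → M)
    (θ : BddFormula k (n + 2)) : Prop :=
  ∃ x : M, ∀ y : M, θ.Holds V (Matrix.vecCons y (Matrix.vecCons x v))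

/-- `(M, S)` is a model of `RCA₀`: it satisfies the basic axioms of arithmetic, induction for
`Σ⁰₁`-formulas and comprehension for `Δ⁰₁`-definable properties, where the formulas may contain
number parameters `v` from `M` and set parameters `V` from `S`. -/
structure IsModelRCA0 (M : Type u) [L2 M] (S : Set (Set M)) : Prop where
  succ_ne_zero : ∀ m : M, m + 1 ≠ 0
  succ_inj : ∀ m n : M, m + 1 = n + 1 → m = n
  add_zero : ∀ m : M, m + 0 = m
  add_succ : ∀ m n : M, m + (n + 1) = (m + n) + 1
  mul_zero : ∀ m : M, m * 0 = 0
  mul_succ : ∀ m n : M, m * (n + 1) = m * n + m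
  not_lt_zero : ∀ m : M, ¬ m < 0
  lt_succ_iff : ∀ m n : M, m < n + 1 ↔ m < n ∨ m = n
  sigma1_induction : ∀ (k n : ℕ) (θ : BddFormula k (n + 2)) (V : Fin k → Set M) (v : Fin n → M),
    (∀ i, V i ∈ S) →
    Sigma1 V (Matrix.vecCons 0 v) θ →
    (∀ m : M, Sigma1 V (Matrix.vecCons m v) θ → Sigma1 V (Matrix.vecCons (m + 1) v) θ) →
    ∀ m : M, Sigma1 V (Matrix.vecCons m v) θ
  delta1_comprehension : ∀ (k n : ℕ) (θ η : BddFormula k (n + 2)) (V : Fin k → Set M)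
    (v : Fin n → M),
    (∀ i, V i ∈ S) →
    (∀ m : M, Sigma1 V (Matrix.vecCons m v) θ ↔ Pi1 V (Matrix.vecCons m v) η) →
    {m : M | Sigma1 V (Matrix.vecCons m v) θ} ∈ S

/-! ## Orders inside a model -/

/-- The usual code of a pair in second order arithmetic. -/
def pair {M : Type u} [L2 M] (a b : M) : M := (a + b) * (a + b) + a

/-- A binary relation on a set of numbers, given by its underlying set and its set of coded
pairs. -/
structure CodedOrder (M : Type u) where
  carrier : Set M
  rel : Set M

/-- `p ≤_Q q`. -/
def CodedOrder.le {M : Type u} [L2 M] (Q : CodedOrder M) (p q : M) : Prop :=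
  pair p q ∈ Q.rel

/-- `p <_Q q`. -/
def CodedOrder.lt {M : Type u} [L2 M] (Q : CodedOrder M) (p q : M) : Prop :=
  Q.le p q ∧ p ≠ q

/-- The discrete order with underlying set `{0, 1, 2}`. -/
def three (M : Type u) [L2 M] : CodedOrder M where
  carrier := {0, 1, 1 + 1}
  rel := {z | ∃ p ∈ ({0, 1, 1 + 1} : Set M), z = pair p p}

/-- The sum `Q₀ ⊕ Q₁` with incomparable summands: its elements are the pairs `⟨i, q⟩` with
`i ∈ {0, 1}` and `q ∈ Qᵢ`, and `⟨i, p⟩ ≤ ⟨j, q⟩` holds when `i = j` and `p ≤ q` in `Qᵢ`. -/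
def oplus {M : Type u} [L2 M] (Q₀ Q₁ : CodedOrder M) : CodedOrder M where
  carrier := {z | (∃ q ∈ Q₀.carrier, z = pair 0 q) ∨ (∃ q ∈ Q₁.carrier, z = pair 1 q)}
  rel := {z |
    (∃ p ∈ Q₀.carrier, ∃ q ∈ Q₀.carrier, Q₀.le p q ∧ z = pair (pair 0 p) (pair 0 q)) ∨
    (∃ p ∈ Q₁.carrier, ∃ q ∈ Q₁.carrier, Q₁.le p q ∧ z = pair (pair 1 p) (pair 1 q))}

/-- `Ω` is a well order in the sense of `(M, S)`: a linear order that belongs to the model and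
for which the model contains no strictly descending sequence `g : M → Ω` (coded as the set of
pairs `⟨n, g(n)⟩`). -/
structure IsWellOrder {M : Type u} [L2 M] (S : Set (Set M)) (Ω : CodedOrder M) : Prop where
  carrier_mem : Ω.carrier ∈ S
  rel_mem : Ω.rel ∈ S
  refl : ∀ p ∈ Ω.carrier, Ω.le p p
  antisymm : ∀ p ∈ Ω.carrier, ∀ q ∈ Ω.carrier, Ω.le p q → Ω.le q p → p = q
  trans : ∀ p ∈ Ω.carrier, ∀ q ∈ Ω.carrier, ∀ r ∈ Ω.carrier, Ω.le p q → Ω.le q r → Ω.le p r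
  total : ∀ p ∈ Ω.carrier, ∀ q ∈ Ω.carrier, Ω.le p q ∨ Ω.le q p
  no_descent : ¬ ∃ G ∈ S,
    (∀ n : M, ∃ p ∈ Ω.carrier, ∀ p' : M, pair n p' ∈ G ↔ p' = p) ∧
    (∀ n p q : M, pair n p ∈ G → pair (n + 1) q ∈ G → Ω.lt q p)

/-! ## `Δ⁰₂`-better quasi orders inside a model -/

/-- `X` is an infinite (that is, unbounded) set of numbers. -/
def IsInf {M : Type u} [L2 M] (X : Set M) : Prop :=
  ∀ n : M, ∃ m ∈ X, n < m

/-- The set `X⁻` that results from `X` by removing the smallest element. -/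
def tail {M : Type u} [L2 M] (X : Set M) : Set M :=
  {n | n ∈ X ∧ ∃ m ∈ X, m < n}

/-- The relation `F` is the graph of a function from the infinite sets of `(M, S)` to `Q`. -/
def IsFunctionTo {M : Type u} [L2 M] (S : Set (Set M)) (Q : CodedOrder M)
    (F : Set M → M → Prop) : Prop :=
  ∀ X ∈ S, IsInf X → ∃ q ∈ Q.carrier, ∀ q' : M, F X q' ↔ q' = q

/-- The function with graph `F` is bad: there is no infinite set `X` with `F(X) ≤_Q F(X⁻)`. -/
def IsBad {M : Type u} [L2 M] (S : Set (Set M)) (Q : CodedOrder M)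
    (F : Set M → M → Prop) : Prop :=
  ¬ ∃ X ∈ S, IsInf X ∧ ∃ p q : M, F X p ∧ F (tail X) q ∧ Q.le p q

/-- The relation `F(X) = q` that is defined by the `Σ⁰₂`-formula `∃ x, ∀ y, θ(y, x, q, v, X, P)`
with number parameters `v` and set parameters `P`. -/
def Sigma2Graph {M : Type u} [L2 M] {k n : ℕ} (θ : BddFormula (k + 1) (n + 3))
    (P : Fin k → Set M) (v : Fin n → M) (X : Set M) (q : M) : Prop :=
  Sigma2 (Matrix.vecCons X P) (Matrix.vecCons q v) θ

/-- `Q` is `Δ⁰₂`-BQO in the sense of `(M, S)`: no `Σ⁰₂`-formula with parameters from the model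
defines a bad function from the infinite sets to `Q`. -/
def IsDelta2BQO {M : Type u} [L2 M] (S : Set (Set M)) (Q : CodedOrder M) : Prop :=
  ∀ (k n : ℕ) (θ : BddFormula (k + 1) (n + 3)) (P : Fin k → Set M) (v : Fin n → M),
    (∀ i, P i ∈ S) → IsFunctionTo S Q (Sigma2Graph θ P v) → ¬ IsBad S Q (Sigma2Graph θ P v)

end RevMath

set_option linter.unusedSectionVars false

/-! Everything rests on one colouring, which is used twice. Suppose that infinite sets carry a label
with two values, 0 and 1, that is never constant along the final segments of an infinite set X. Let
m be the first element of X at which the label of the final segment differs from that of X, and let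
j be the number of elements of X below m. Colour X by its label if j is odd and by 2 if j is even.
When the step from X to X⁻ does not cross the change, m and the label persist while j drops by one,
so the label and 2 alternate. When it does, j is 1, so X has its label as colour, while X⁻ has the
opposite label or 2. So the colouring with values in **3** is bad (`isBad_three`). If the first
change, together with its direction, is Σ⁰₂-definable, then this contradicts the assumption on **3**
(`not_isDelta2BQO_three`).

The first application yields arithmetical comprehension (`sigma1_comprehension`). Enumerate a
Σ⁰₁-set K that is not in the model, and call a stage true if no smaller number enters after it.
Label X by whether the interval between its first two elements contains a true stage. If this held
along all final segments of X, then K would be decidable with the help of X. If it always failed,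
then nothing would enter from some stage on, since the smallest number to enter from there on does
so at a true stage; again K would be in the model. So the label changes.

The second application labels X by the summand to which F(X) belongs, for a supposedly bad F with
values in Ω ⊕ Ω. If the label were constant along the final segments of X, then badness would make
the values of F descend in Ω, and arithmetical comprehension would put this sequence into the model
(`exists_not_summand`). So the label changes again. Comprehension also provides the collection that
makes the first change Σ⁰₂-definable (`changeMatrix_iff`).

Since M can be nonstandard, every induction and comprehension needs a formula. The class `Def0` lets
instance search find bounded formulas with parameters, and finite sets are coded by divisibility in
the style of Gödel's β-function. -/

namespace RevMath

/-! ## Renaming of variables and restriction of set variables -/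

/-- Renaming of number variables in a term. -/
def NumTerm.rename {n m : ℕ} (ρ : Fin n → Fin m) : NumTerm n → NumTerm m
  | .var i => .var (ρ i)
  | .zero => .zero
  | .one => .one
  | .add s t => .add (s.rename ρ) (t.rename ρ)
  | .mul s t => .mul (s.rename ρ) (t.rename ρ)

theorem NumTerm.val_rename {M : Type u} [L2 M] {n m : ℕ} (ρ : Fin n → Fin m) (v : Fin m → M)
    (t : NumTerm n) : (t.rename ρ).val v = t.val (fun i => v (ρ i)) := by
  induction t with
  | var i => rfl
  | zero => rfl
  | one => rfl
  | add s t hs ht => simp only [rename, val, hs, ht]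
  | mul s t hs ht => simp only [rename, val, hs, ht]

/-- The extension of a renaming to a fresh variable number `0`. -/
def liftRename {n m : ℕ} (ρ : Fin n → Fin m) : Fin (n + 1) → Fin (m + 1) :=
  Matrix.vecCons 0 (fun i => (ρ i).succ)

theorem vecCons_liftRename {M : Type u} {n m : ℕ} (ρ : Fin n → Fin m) (x : M) (v : Fin m → M) :
    (fun i => Matrix.vecCons x v (liftRename ρ i)) = Matrix.vecCons x (fun i => v (ρ i)) := by
  funext i
  refine Fin.cases ?_ (fun j => ?_) i <;> simp [liftRename]

/-- Renaming of the set variables and the number variables in a bounded formula. -/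
def BddFormula.rename {k l : ℕ} (τ : Fin k → Fin l) :
    {n m : ℕ} → (Fin n → Fin m) → BddFormula k n → BddFormula l m
  | _, _, ρ, .eq s t => .eq (s.rename ρ) (t.rename ρ)
  | _, _, ρ, .lt s t => .lt (s.rename ρ) (t.rename ρ)
  | _, _, ρ, .mem t i => .mem (t.rename ρ) (τ i)
  | _, _, ρ, .neg φ => .neg (φ.rename τ ρ)
  | _, _, ρ, .and φ ψ => .and (φ.rename τ ρ) (ψ.rename τ ρ)
  | _, _, ρ, .ball t φ => .ball (t.rename ρ) (φ.rename τ (liftRename ρ))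

theorem BddFormula.holds_rename {M : Type u} [L2 M] {k l : ℕ} (τ : Fin k → Fin l)
    (V : Fin l → Set M) {n : ℕ} (φ : BddFormula k n) : ∀ {m : ℕ} (ρ : Fin n → Fin m)
    (v : Fin m → M),
    (φ.rename τ ρ).Holds V v ↔ φ.Holds (fun i => V (τ i)) (fun i => v (ρ i)) := by
  induction φ with
  | eq s t => intro m ρ v; simp only [rename, Holds, NumTerm.val_rename]
  | lt s t => intro m ρ v; simp only [rename, Holds, NumTerm.val_rename]
  | mem t i => intro m ρ v; simp only [rename, Holds, NumTerm.val_rename]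
  | neg φ ih => intro m ρ v; simp only [rename, Holds, ih]
  | and φ ψ ih₁ ih₂ => intro m ρ v; simp only [rename, Holds, ih₁, ih₂]
  | ball t φ ih =>
    intro m ρ v
    simp only [rename, Holds, NumTerm.val_rename, ih, vecCons_liftRename]

/-- The formula that results when each set variable `Xᵢ` with `p i` is replaced by its final
segment of elements that are not below the number variable `z`. -/
def BddFormula.restrict {k : ℕ} (p : Fin k → Bool) :
    {n : ℕ} → Fin n → BddFormula k n → BddFormula k n
  | _, _, .eq s t => .eq s t
  | _, _, .lt s t => .lt s t
  | _, z, .mem t i => if p i then .and (.mem t i) (.neg (.lt t (.var z))) else .mem t i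
  | _, z, .neg φ => .neg (φ.restrict p z)
  | _, z, .and φ ψ => .and (φ.restrict p z) (ψ.restrict p z)
  | _, z, .ball t φ => .ball t (φ.restrict p z.succ)

theorem BddFormula.holds_restrict {M : Type u} [L2 M] {k : ℕ} (p : Fin k → Bool)
    (V : Fin k → Set M) {n : ℕ} (φ : BddFormula k n) : ∀ (z : Fin n) (v : Fin n → M),
    (φ.restrict p z).Holds V v ↔
      φ.Holds (fun i => if p i then {x | x ∈ V i ∧ ¬ x < v z} else V i) v := by
  induction φ with
  | eq s t => intro z v; simp only [restrict, Holds]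
  | lt s t => intro z v; simp only [restrict, Holds]
  | mem t i =>
    intro z v
    by_cases h : p i = true <;> simp [restrict, Holds, h, NumTerm.val]
  | neg φ ih => intro z v; simp only [restrict, Holds, ih]
  | and φ ψ ih₁ ih₂ => intro z v; simp only [restrict, Holds, ih₁, ih₂]
  | ball t φ ih => intro z v; simp only [restrict, Holds, ih, Matrix.cons_val_succ]

/-! ## Definability with parameters -/

section Definability

variable {M : Type u} [L2 M]

/-- The function `t` is the value of a term with parameters from `M`. -/
class IsTerm {n : ℕ} (t : (Fin n → M) → M) : Prop where
  out : ∃ (N : ℕ) (s : NumTerm N) (σ : Fin N → Fin n ⊕ M),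
    ∀ v, s.val (fun i => Sum.elim v id (σ i)) = t v

/-- The relation `P` between a set and a tuple of numbers is defined by a bounded formula with
number parameters from `M` and set parameters from `S`. -/
class Def0 (S : Set (Set M)) {n : ℕ} (P : Set M → (Fin n → M) → Prop) : Prop where
  out : ∃ (k N : ℕ) (θ : BddFormula k N) (A : Fin k → Option (Set M)) (σ : Fin N → Fin n ⊕ M),
    (∀ i, ∀ B ∈ A i, B ∈ S) ∧
    ∀ X v, θ.Holds (fun i => (A i).getD X) (fun i => Sum.elim v id (σ i)) ↔ P X v

namespace IsTerm

variable {n : ℕ}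

instance var (i : Fin n) : IsTerm (fun v : Fin n → M => v i) :=
  ⟨1, .var 0, fun _ => .inl i, fun _ => rfl⟩

instance const (c : M) : IsTerm (fun _ : Fin n → M => c) :=
  ⟨1, .var 0, fun _ => .inr c, fun _ => rfl⟩

theorem binary {s t : (Fin n → M) → M} (hs : IsTerm s) (ht : IsTerm t) (op : M → M → M)
    (f : ∀ {N : ℕ}, NumTerm N → NumTerm N → NumTerm N)
    (hf : ∀ {N : ℕ} (v : Fin N → M) (a b : NumTerm N), (f a b).val v = op (a.val v) (b.val v)) :
    IsTerm (fun v => op (s v) (t v)) := by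
  obtain ⟨N₁, a, σ, ha⟩ := hs
  obtain ⟨N₂, b, τ, hb⟩ := ht
  refine ⟨N₁ + N₂, f (a.rename (Fin.castAdd N₂)) (b.rename (Fin.natAdd N₁)),
    Fin.addCases σ τ, fun v => ?_⟩
  simp only [hf, NumTerm.val_rename, Fin.addCases_left, Fin.addCases_right, ha, hb]

instance add (s t : (Fin n → M) → M) [hs : IsTerm s] [ht : IsTerm t] :
    IsTerm (fun v => s v + t v) := hs.binary ht _ .add (fun _ _ _ => rfl)

instance mul (s t : (Fin n → M) → M) [hs : IsTerm s] [ht : IsTerm t] :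
    IsTerm (fun v => s v * t v) := hs.binary ht _ .mul (fun _ _ _ => rfl)

instance pair (s t : (Fin n → M) → M) [hs : IsTerm s] [ht : IsTerm t] :
    IsTerm (fun v => pair (s v) (t v)) := by
  unfold RevMath.pair; infer_instance

end IsTerm

namespace Def0

variable {S : Set (Set M)} {n : ℕ}

theorem congr {P Q : Set M → (Fin n → M) → Prop} (hP : Def0 S P) (h : ∀ X v, P X v ↔ Q X v) :
    Def0 S Q := by
  have : P = Q := by funext X v; exact propext (h X v)
  exact this ▸ hP

theorem rel {s t : (Fin n → M) → M} (hs : IsTerm s) (ht : IsTerm t) (R : M → M → Prop)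
    (f : ∀ {N : ℕ}, NumTerm N → NumTerm N → BddFormula 0 N)
    (hf : ∀ {N : ℕ} (V : Fin 0 → Set M) (v : Fin N → M) (a b : NumTerm N),
      (f a b).Holds V v ↔ R (a.val v) (b.val v)) :
    Def0 S (fun _ v => R (s v) (t v)) := by
  obtain ⟨N₁, a, σ, ha⟩ := hs
  obtain ⟨N₂, b, τ, hb⟩ := ht
  refine ⟨0, N₁ + N₂, f (a.rename (Fin.castAdd N₂)) (b.rename (Fin.natAdd N₁)),
    fun i => i.elim0, Fin.addCases σ τ, fun i => i.elim0, fun X v => ?_⟩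
  simp only [hf, NumTerm.val_rename, Fin.addCases_left, Fin.addCases_right, ha, hb]

instance eq (s t : (Fin n → M) → M) [hs : IsTerm s] [ht : IsTerm t] :
    Def0 S (fun _ v => s v = t v) := rel hs ht (· = ·) .eq (fun _ _ _ _ => Iff.rfl)

instance lt (s t : (Fin n → M) → M) [hs : IsTerm s] [ht : IsTerm t] :
    Def0 S (fun _ v => s v < t v) := rel hs ht (· < ·) .lt (fun _ _ _ _ => Iff.rfl)

instance mem (t : (Fin n → M) → M) [ht : IsTerm t] : Def0 S (fun X v => t v ∈ X) := by
  obtain ⟨N, a, σ, ha⟩ := ht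
  refine ⟨1, N, .mem a 0, fun _ => none, σ, fun i B hB => by simp at hB, fun X v => ?_⟩
  simp only [BddFormula.Holds, ha, Option.getD]

theorem mem_const {A : Set M} (hA : A ∈ S) (t : (Fin n → M) → M) [ht : IsTerm t] :
    Def0 S (fun _ v => t v ∈ A) := by
  obtain ⟨N, a, σ, ha⟩ := ht
  refine ⟨1, N, .mem a 0, fun _ => some A, σ, fun i B hB => by cases hB; exact hA, fun X v => ?_⟩
  simp only [BddFormula.Holds, ha, Option.getD]

instance mem_fact {A : Set M} [hA : Fact (A ∈ S)] (t : (Fin n → M) → M) [IsTerm t] :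
    Def0 S (fun _ v => t v ∈ A) := mem_const hA.out t

instance not (P : Set M → (Fin n → M) → Prop) [hP : Def0 S P] : Def0 S (fun X v => ¬ P X v) := by
  obtain ⟨k, N, θ, A, σ, hA, h⟩ := hP
  exact ⟨k, N, .neg θ, A, σ, hA, fun X v => not_congr (h X v)⟩

instance and (P Q : Set M → (Fin n → M) → Prop) [hP : Def0 S P] [hQ : Def0 S Q] :
    Def0 S (fun X v => P X v ∧ Q X v) := by
  obtain ⟨k, N, θ, A, σ, hA, h⟩ := hP
  obtain ⟨k', N', θ', A', σ', hA', h'⟩ := hQ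
  refine ⟨k + k', N + N', .and (θ.rename (Fin.castAdd k') (Fin.castAdd N'))
    (θ'.rename (Fin.natAdd k) (Fin.natAdd N)), Fin.addCases A A', Fin.addCases σ σ', ?_, ?_⟩
  · refine Fin.addCases (fun i => ?_) (fun i => ?_)
    · simpa only [Fin.addCases_left] using hA i
    · simpa only [Fin.addCases_right] using hA' i
  · intro X v
    simp only [BddFormula.Holds, BddFormula.holds_rename, Fin.addCases_left, Fin.addCases_right,
      h, h']

instance or (P Q : Set M → (Fin n → M) → Prop) [Def0 S P] [Def0 S Q] :
    Def0 S (fun X v => P X v ∨ Q X v) :=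
  (inferInstance : (Def0 S (fun X v => ¬ (¬ P X v ∧ ¬ Q X v)))).congr
    (fun _ _ => by tauto)

instance imp (P Q : Set M → (Fin n → M) → Prop) [Def0 S P] [Def0 S Q] :
    Def0 S (fun X v => P X v → Q X v) :=
  (inferInstance : (Def0 S (fun X v => ¬ (P X v ∧ ¬ Q X v)))).congr
    (fun _ _ => by tauto)

instance iff (P Q : Set M → (Fin n → M) → Prop) [Def0 S P] [Def0 S Q] :
    Def0 S (fun X v => P X v ↔ Q X v) :=
  (inferInstance : (Def0 S (fun X v => (P X v → Q X v) ∧ (Q X v → P X v)))).congr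
    (fun _ _ => by tauto)

instance const (p : Prop) : Def0 S (fun _ (_ : Fin n → M) => p) := by
  by_cases hp : p
  · exact (inferInstance : (Def0 S (fun _ _ => (0 : M) = 0))).congr (fun _ _ => by simp [hp])
  · exact (inferInstance : (Def0 S (fun _ _ => ¬ (0 : M) = 0))).congr (fun _ _ => by simp [hp])

open Classical in
instance ball (t : (Fin n → M) → M) (P : Set M → M → (Fin n → M) → Prop) [ht : IsTerm t]
    [hP : Def0 S (fun X (w : Fin (n + 1) → M) => P X (w 0) (fun i => w i.succ))] :
    Def0 S (fun X v => ∀ x, x < t v → P X x v) := by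
  obtain ⟨N₁, a, τ, ha⟩ := ht
  obtain ⟨k, N, θ, A, σ, hA, h⟩ := hP
  -- Several slots of `θ` may refer to the bound variable. They are all merged into variable 0, and
  -- each other slot keeps a variable of its own.
  let ρ : Fin N → Fin (N₁ + N + 1) := fun i =>
    if σ i = .inl 0 then 0 else (Fin.natAdd N₁ i).succ
  let σ' : Fin N → Fin n ⊕ M := fun i =>
    match σ i with
    -- The value 0 is a dummy: slots that referred to the bound variable are no longer read.
    | .inl j => Fin.cases (.inr 0) (fun j => .inl j) j
    | .inr c => .inr c
  refine ⟨k, N₁ + N, .ball (a.rename (Fin.castAdd N)) (θ.rename id ρ), A,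
    Fin.addCases τ σ', hA, fun X v => ?_⟩
  simp only [BddFormula.Holds, NumTerm.val_rename, Fin.addCases_left, ha]
  refine forall_congr' fun x => imp_congr_right fun _ => ?_
  rw [BddFormula.holds_rename]
  have key : (fun i => Matrix.vecCons x
      (fun i => Sum.elim v id ((Fin.addCases τ σ' : Fin (N₁ + N) → Fin n ⊕ M) i)) (ρ i)) =
      fun i => Sum.elim (Matrix.vecCons x v) id (σ i) := by
    funext i
    by_cases hi : σ i = .inl 0
    · simp [ρ, hi]
    · simp only [ρ, if_neg hi, Matrix.cons_val_succ, Fin.addCases_right]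
      rcases hs : σ i with j | c
      · have hj : j ≠ 0 := fun e => hi (by rw [hs, e])
        obtain ⟨j, rfl⟩ := Fin.exists_succ_eq.2 hj
        simp [σ', hs]
      · simp [σ', hs]
  rw [key]
  simpa using h X (Matrix.vecCons x v)

instance bex (t : (Fin n → M) → M) (P : Set M → M → (Fin n → M) → Prop) [IsTerm t]
    [Def0 S (fun X (w : Fin (n + 1) → M) => P X (w 0) (fun i => w i.succ))] :
    Def0 S (fun X v => ∃ x, x < t v ∧ P X x v) :=
  (inferInstance : (Def0 S (fun X v => ¬ ∀ x, x < t v → ¬ P X x v))).congr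
    (fun _ _ => by push Not; rfl)

/-- Substitution of variables and constants for the number variables. -/
theorem subst {m : ℕ} {P : Set M → (Fin n → M) → Prop} (hP : Def0 S P) (ρ : Fin n → Fin m ⊕ M) :
    Def0 S (fun X (w : Fin m → M) => P X (fun i => Sum.elim w id (ρ i))) := by
  obtain ⟨k, N, θ, A, σ, hA, h⟩ := hP
  refine ⟨k, N, θ, A, fun i => Sum.elim ρ .inr (σ i), hA, fun X v => ?_⟩
  rw [← h]
  have : (fun i => Sum.elim v id (Sum.elim ρ .inr (σ i))) =
      fun i => Sum.elim (fun i => Sum.elim v id (ρ i)) id (σ i) := by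
    funext i
    rcases σ i with j | c <;> rfl
  rw [this]

/-- Instantiation of the set variable. -/
theorem inst {P : Set M → (Fin n → M) → Prop} (hP : Def0 S P) {A : Set M} (hA : A ∈ S) :
    Def0 S (fun _ v => P A v) := by
  obtain ⟨k, N, θ, B, σ, hB, h⟩ := hP
  refine ⟨k, N, θ, fun i => some ((B i).getD A), σ, ?_, fun X v => ?_⟩
  · intro i C hC
    cases hC
    rcases hi : B i with _ | C
    · exact hA
    · exact hB i C hi
  · simpa using h A v

/-- Restriction of the set variable to a final segment. -/
theorem restrict {P : Set M → (Fin n → M) → Prop} (hP : Def0 S P) (z : Fin n) :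
    Def0 S (fun X v => P {x | x ∈ X ∧ ¬ x < v z} v) := by
  obtain ⟨k, N, θ, A, σ, hA, h⟩ := hP
  refine ⟨k, N + 1, (θ.rename id Fin.succ).restrict (fun i => (A i).isNone) 0, A,
    Matrix.vecCons (.inl z) σ, hA, fun X v => ?_⟩
  rw [BddFormula.holds_restrict, BddFormula.holds_rename, ← h]
  have : (fun i => if (A i).isNone = true then {x | x ∈ (A i).getD X ∧ ¬ x < v z}
      else (A i).getD X) = fun i => (A i).getD {x | x ∈ X ∧ ¬ x < v z} := by
    funext i
    rcases A i with _ | B <;> simp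
  simp only [Matrix.cons_val_zero, Matrix.cons_val_succ, Sum.elim_inl, id]
  rw [this]

end Def0

end Definability

section

variable {M : Type u} [L2 M] {S : Set (Set M)}

open Classical in
/-- A definable relation is defined by an actual formula with any desired arrangement of the
number variables. -/
theorem Def0.exists_formula {n : ℕ} {P : Set M → (Fin n → M) → Prop} (hP : Def0 S P)
    {B : Set M} (hB : B ∈ S) :
    ∃ (k N : ℕ) (A : Fin k → Set M) (p : Fin N → M), (∀ i, A i ∈ S) ∧
      ∀ (L : ℕ) (ι : Fin n → Fin L) (κ : Fin N → Fin L), ∃ θ : BddFormula (k + 1) L,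
        ∀ X v, (∀ i, v (κ i) = p i) →
          (θ.Holds (Matrix.vecCons X A) v ↔ P X (fun j => v (ι j))) := by
  obtain ⟨k, N, θ, A, σ, hA, h⟩ := hP
  -- The defaults `B` and 0 fill slots that are redirected below to the set variable and to the
  -- arguments, so their values do not matter.
  refine ⟨k, N, fun i => (A i).getD B, fun i => Sum.elim (fun _ => 0) id (σ i), ?_, ?_⟩
  · intro i
    rcases hi : A i with _ | C
    · simpa [hi] using hB
    · simpa [hi] using hA i C hi
  · intro L ι κ
    refine ⟨θ.rename (fun i => if A i = none then 0 else i.succ)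
      (fun i => Sum.elim ι (fun _ => κ i) (σ i)), fun X v hv => ?_⟩
    rw [BddFormula.holds_rename, ← h]
    have h₁ : (fun i => Matrix.vecCons X (fun i => (A i).getD B)
        (if A i = none then 0 else i.succ)) = fun i => (A i).getD X := by
      funext i
      rcases hi : A i with _ | C <;> simp [hi]
    have h₂ : (fun i => v (Sum.elim ι (fun _ => κ i) (σ i))) =
        fun i => Sum.elim (fun j => v (ι j)) id (σ i) := by
      funext i
      rcases hi : σ i with j | c
      · rfl
      · simpa [hi] using hv i
    rw [h₁, h₂]

/-! ### Induction and comprehension for definable relations -/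

namespace IsModelRCA0

theorem nonempty (h : IsModelRCA0 M S) : S.Nonempty :=
  ⟨_, h.delta1_comprehension 0 0 (.eq .zero .zero) (.eq .zero .zero) (fun i => i.elim0)
    (fun i => i.elim0) (fun i => i.elim0) (fun _ => ⟨fun _ _ => rfl, fun _ => ⟨0, rfl⟩⟩)⟩

theorem induction_ex (h : IsModelRCA0 M S) {Q : M → M → Prop}
    (hQ : Def0 S (fun _ (w : Fin 2 → M) => Q (w 0) (w 1)))
    (h0 : ∃ x, Q x 0) (hs : ∀ m, (∃ x, Q x m) → ∃ x, Q x (m + 1)) (m : M) : ∃ x, Q x m := by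
  -- The relation ignores its set variable, but the formula has a slot for one; any set of the model
  -- can fill it.
  obtain ⟨B, hB⟩ := h.nonempty
  obtain ⟨k, N, A, p, hA, hθ⟩ := hQ.exists_formula hB
  obtain ⟨θ, hθ⟩ := hθ (N + 2) ![0, 1] (fun i => i.succ.succ)
  have key : ∀ m, Sigma1 (Matrix.vecCons B A) (Matrix.vecCons m p) θ ↔ ∃ x, Q x m := by
    intro m
    refine exists_congr fun x => ?_
    simpa using hθ B (Matrix.vecCons x (Matrix.vecCons m p)) (fun i => by simp)
  refine (key m).1 (h.sigma1_induction (k + 1) N θ (Matrix.vecCons B A) p ?_ ((key 0).2 h0)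
    (fun m hm => (key _).2 (hs m ((key m).1 hm))) m)
  exact Fin.cases hB hA

theorem induction (h : IsModelRCA0 M S) {P : M → Prop}
    (hP : Def0 S (fun _ (w : Fin 1 → M) => P (w 0)))
    (h0 : P 0) (hs : ∀ m, P m → P (m + 1)) (m : M) : P m :=
  (h.induction_ex (Q := fun _ m => P m) (hP.subst ![.inl (1 : Fin 2)]) ⟨0, h0⟩
    (fun m ⟨x, hx⟩ => ⟨x, hs m hx⟩) m).elim fun _ hx => hx

theorem comprehension (h : IsModelRCA0 M S) {Q R : M → M → Prop}
    (hQ : Def0 S (fun _ (w : Fin 2 → M) => Q (w 0) (w 1)))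
    (hR : Def0 S (fun _ (w : Fin 2 → M) => R (w 0) (w 1)))
    (hQR : ∀ m, (∃ x, Q x m) ↔ ∀ x, R x m) : {m | ∃ x, Q x m} ∈ S := by
  obtain ⟨B, hB⟩ := h.nonempty
  obtain ⟨k, N, A, p, hA, hθ⟩ := hQ.exists_formula hB
  obtain ⟨k', N', A', p', hA', hη⟩ := hR.exists_formula hB
  obtain ⟨θ, hθ⟩ := hθ ((N + N') + 2) ![0, 1] (fun i => (Fin.castAdd N' i).succ.succ)
  obtain ⟨η, hη⟩ := hη ((N + N') + 2) ![0, 1] (fun i => (Fin.natAdd N i).succ.succ)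
  -- The comprehension axiom wants both formulas over the same parameters, so the two parameter
  -- lists are concatenated.
  let V : Fin ((k + 1) + (k' + 1)) → Set M :=
    Fin.addCases (Matrix.vecCons B A) (Matrix.vecCons B A')
  let p₂ : Fin (N + N') → M := Fin.addCases p p'
  have hV : ∀ i, V i ∈ S := by
    refine Fin.addCases (fun i => ?_) (fun i => ?_)
    · simp only [V, Fin.addCases_left]; exact Fin.cases hB hA i
    · simp only [V, Fin.addCases_right]; exact Fin.cases hB hA' i
  have key₁ : ∀ m, Sigma1 V (Matrix.vecCons m p₂) (θ.rename (Fin.castAdd (k' + 1)) id) ↔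
      ∃ x, Q x m := by
    intro m
    refine exists_congr fun x => ?_
    rw [BddFormula.holds_rename]
    simpa [V, p₂] using hθ B (Matrix.vecCons x (Matrix.vecCons m p₂)) (fun i => by simp [p₂])
  have key₂ : ∀ m, Pi1 V (Matrix.vecCons m p₂) (η.rename (Fin.natAdd (k + 1)) id) ↔
      ∀ x, R x m := by
    intro m
    refine forall_congr' fun x => ?_
    rw [BddFormula.holds_rename]
    simpa [V, p₂] using hη B (Matrix.vecCons x (Matrix.vecCons m p₂)) (fun i => by simp [p₂])
  have := h.delta1_comprehension _ _ (θ.rename (Fin.castAdd (k' + 1)) id)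
    (η.rename (Fin.natAdd (k + 1)) id) V p₂ hV
    (fun m => (key₁ m).trans ((hQR m).trans (key₂ m).symm))
  simpa only [key₁] using this

theorem def0_mem (h : IsModelRCA0 M S) {P : M → Prop}
    (hP : Def0 S (fun _ (w : Fin 1 → M) => P (w 0))) : {m | P m} ∈ S := by
  have h2 : Def0 S (fun _ (w : Fin 2 → M) => P (w 1)) := hP.subst ![.inl (1 : Fin 2)]
  have := h.comprehension (Q := fun _ m => P m) (R := fun _ m => P m) h2 h2
    (fun m => ⟨fun ⟨_, hx⟩ _ => hx, fun hx => ⟨0, hx 0⟩⟩)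
  simpa using this

end IsModelRCA0

end

/-! ## Basic arithmetic -/

/-- The algebraic laws of the ordered semiring of numbers. -/
class IsArith (M : Type u) [L2 M] : Prop where
  addAssoc : ∀ a b c : M, a + b + c = a + (b + c)
  addComm : ∀ a b : M, a + b = b + a
  addZero : ∀ a : M, a + 0 = a
  mulAssoc : ∀ a b c : M, a * b * c = a * (b * c)
  mulComm : ∀ a b : M, a * b = b * a
  mulOne : ∀ a : M, a * 1 = a
  mulZero : ∀ a : M, a * 0 = 0
  mulAdd : ∀ a b c : M, a * (b + c) = a * b + a * c
  addCancel : ∀ a b c : M, a + c = b + c → a = b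
  ltIff : ∀ a b : M, a < b ↔ ∃ c, b = a + c + 1
  ltTrichotomy : ∀ a b : M, a < b ∨ a = b ∨ b < a
  ltIrrefl : ∀ a : M, ¬ a < a
  zeroOrSucc : ∀ a : M, a = 0 ∨ ∃ b, a = b + 1

/-- Most laws are equations or bounded statements in the last variable, with the others as
parameters, so induction applies directly. Predecessors and differences are obtained as witnesses in
Σ⁰₁-inductions. -/
theorem IsModelRCA0.isArith {M : Type u} [L2 M] {S : Set (Set M)} (h : IsModelRCA0 M S) :
    IsArith M := by
  have ind : ∀ {P : M → Prop}, Def0 S (fun _ (w : Fin 1 → M) => P (w 0)) →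
      P 0 → (∀ m, P m → P (m + 1)) → ∀ m, P m := fun hP => h.induction hP
  have add_assoc : ∀ a b c : M, a + b + c = a + (b + c) := fun a b =>
    ind inferInstance (by rw [h.add_zero, h.add_zero])
      (fun m hm => by rw [h.add_succ, hm, h.add_succ, h.add_succ])
  have zero_add : ∀ a : M, 0 + a = a :=
    ind inferInstance (h.add_zero 0) (fun m hm => by rw [h.add_succ, hm])
  have succ_add : ∀ a b : M, a + 1 + b = a + b + 1 := fun a =>
    ind inferInstance (by rw [h.add_zero, h.add_zero])
      (fun m hm => by rw [h.add_succ, hm, h.add_succ])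
  have add_comm : ∀ a b : M, a + b = b + a := fun a =>
    ind inferInstance (by rw [h.add_zero, zero_add])
      (fun m hm => by rw [h.add_succ, hm, succ_add])
  have mul_add : ∀ a b c : M, a * (b + c) = a * b + a * c := fun a b =>
    ind inferInstance (by rw [h.add_zero, h.mul_zero, h.add_zero])
      (fun m hm => by rw [h.add_succ, h.mul_succ, hm, h.mul_succ, add_assoc])
  have mul_assoc : ∀ a b c : M, a * b * c = a * (b * c) := fun a b =>
    ind inferInstance (by rw [h.mul_zero, h.mul_zero, h.mul_zero])
      (fun m hm => by rw [h.mul_succ, hm, h.mul_succ, mul_add])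
  have zero_mul : ∀ a : M, 0 * a = 0 :=
    ind inferInstance (h.mul_zero 0) (fun m hm => by rw [h.mul_succ, hm, h.add_zero])
  have succ_mul : ∀ a b : M, (a + 1) * b = a * b + b := fun a =>
    ind inferInstance (by rw [h.mul_zero, h.mul_zero, h.add_zero])
      (fun m hm => by
        rw [h.mul_succ, hm, h.mul_succ, add_assoc, add_assoc, h.add_succ, h.add_succ, h.add_succ,
          add_comm m, h.add_succ])
  have mul_comm : ∀ a b : M, a * b = b * a := fun a =>
    ind inferInstance (by rw [h.mul_zero, zero_mul])
      (fun m hm => by rw [h.mul_succ, hm, succ_mul])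
  have mul_one : ∀ a : M, a * 1 = a := fun a => by
    have := h.mul_succ a 0
    rwa [zero_add, h.mul_zero, zero_add] at this
  have cancel : ∀ a b c : M, a + c = b + c → a = b := fun a b =>
    ind inferInstance (fun e => by rwa [h.add_zero, h.add_zero] at e)
      (fun m hm e => hm (h.succ_inj _ _ (by rwa [h.add_succ, h.add_succ] at e)))
  have ez : ∀ a : M, a = 0 ∨ ∃ b, a = b + 1 := fun a => by
    have : ∃ x, (a = 0 ∨ a = x + 1) :=
      h.induction_ex (Q := fun x a => a = 0 ∨ a = x + 1) inferInstance ⟨0, .inl rfl⟩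
        (fun m _ => ⟨m, .inr rfl⟩) a
    obtain ⟨x, hx | hx⟩ := this
    exacts [.inl hx, .inr ⟨x, hx⟩]
  have lt1 : ∀ a c : M, a < a + c + 1 := fun a =>
    ind inferInstance (by rw [h.add_zero]; exact (h.lt_succ_iff _ _).2 (.inr rfl))
      (fun m hm => by rw [h.add_succ]; exact (h.lt_succ_iff _ _).2 (.inl hm))
  have lt2 : ∀ a b : M, a < b → ∃ c, b = a + c + 1 := fun a b hab => by
    have : ∃ c, (a < b → b = a + c + 1) := by
      refine h.induction_ex (Q := fun c b => a < b → b = a + c + 1) inferInstance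
        ⟨0, fun hb => (h.not_lt_zero _ hb).elim⟩ (fun m ⟨c, hc⟩ => ?_) b
      by_cases hm : a < m
      · exact ⟨c + 1, fun _ => by rw [h.add_succ, ← hc hm]⟩
      · refine ⟨0, fun hb => ?_⟩
        rcases (h.lt_succ_iff _ _).1 hb with hb | rfl
        · exact (hm hb).elim
        · rw [h.add_zero]
    obtain ⟨c, hc⟩ := this
    exact ⟨c, hc hab⟩
  have lt_iff : ∀ a b : M, a < b ↔ ∃ c, b = a + c + 1 := fun a b =>
    ⟨lt2 a b, fun ⟨c, hc⟩ => hc ▸ lt1 a c⟩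
  have irr : ∀ a : M, ¬ a < a := fun a ha => by
    obtain ⟨c, hc⟩ := lt2 a a ha
    refine h.succ_ne_zero c (cancel _ _ a ?_)
    rw [zero_add, add_comm, ← add_assoc, ← hc]
  have zl : ∀ a : M, 0 = a ∨ 0 < a := ind inferInstance (.inl rfl) (fun m hm => by
    refine .inr ((h.lt_succ_iff _ _).2 ?_)
    exact hm.symm)
  have tri : ∀ a b : M, a < b ∨ a = b ∨ b < a := fun a =>
    ind inferInstance (.inr ((zl a).imp Eq.symm id)) (fun m hm => by
      rcases hm with hm | rfl | hm
      · exact .inl ((h.lt_succ_iff _ _).2 (.inl hm))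
      · exact .inl ((h.lt_succ_iff _ _).2 (.inr rfl))
      · obtain ⟨c, rfl⟩ := lt2 _ _ hm
        rcases ez c with rfl | ⟨d, rfl⟩
        · exact .inr (.inl (by rw [h.add_zero]))
        · refine .inr (.inr ?_)
          rw [add_comm d, ← add_assoc m]
          exact lt1 _ _)
  exact ⟨add_assoc, add_comm, h.add_zero, mul_assoc, mul_comm, mul_one, h.mul_zero, mul_add, cancel,
    lt_iff, tri, irr, ez⟩

/-! ### The numbers as an ordered commutative semiring -/

section

variable {M : Type u} [L2 M] [IsArith M]

open IsArith

noncomputable instance : CommSemiring M where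
  zero := 0
  one := 1
  add := (· + ·)
  mul := (· * ·)
  add_assoc := addAssoc
  add_comm := addComm
  zero_add a := (addComm _ _).trans (addZero a)
  add_zero := addZero
  mul_assoc := mulAssoc
  mul_comm := mulComm
  one_mul a := (mulComm _ _).trans (mulOne a)
  mul_one := mulOne
  zero_mul a := (mulComm _ _).trans (mulZero a)
  mul_zero := mulZero
  left_distrib := mulAdd
  right_distrib a b c := by rw [mulComm _ c, mulAdd, mulComm c, mulComm c]
  nsmul := nsmulRec
  npow := npowRec
  natCast := Nat.unaryCast

theorem numbers_lt_trans {a b c : M} (hab : a < b) (hbc : b < c) : a < c := by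
  rw [ltIff] at *
  obtain ⟨d, rfl⟩ := hab
  obtain ⟨e, rfl⟩ := hbc
  exact ⟨d + e + 1, by ring⟩

noncomputable instance : LinearOrder M where
  lt := (· < ·)
  le a b := a < b ∨ a = b
  le_refl _ := .inr rfl
  le_trans a b c hab hbc := by
    rcases hab with hab | rfl
    · rcases hbc with hbc | rfl
      · exact .inl (numbers_lt_trans hab hbc)
      · exact .inl hab
    · exact hbc
  le_antisymm a b hab hba := by
    rcases hab with hab | rfl
    · rcases hba with hba | rfl
      · exact (ltIrrefl _ (numbers_lt_trans hab hba)).elim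
      · rfl
    · rfl
  le_total a b := by
    rcases ltTrichotomy a b with h | h | h
    exacts [.inl (.inl h), .inl (.inr h), .inr (.inl h)]
  lt_iff_le_not_ge a b := by
    constructor
    · intro hab
      refine ⟨.inl hab, ?_⟩
      rintro (hba | rfl)
      · exact ltIrrefl _ (numbers_lt_trans hab hba)
      · exact ltIrrefl _ hab
    · rintro ⟨hab | rfl, h⟩
      · exact hab
      · exact (h (.inr rfl)).elim
  toDecidableLE := Classical.decRel _
  toDecidableEq := Classical.decEq _
  toDecidableLT := Classical.decRel _

theorem numbers_le_iff {a b : M} : a ≤ b ↔ ∃ c, b = a + c := by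
  constructor
  · rintro (h | rfl)
    · obtain ⟨c, rfl⟩ := (ltIff a b).1 h
      exact ⟨c + 1, by ring⟩
    · exact ⟨0, (addZero a).symm⟩
  · rintro ⟨c, rfl⟩
    rcases zeroOrSucc c with rfl | ⟨d, rfl⟩
    · exact .inr (addZero a).symm
    · exact .inl ((ltIff _ _).2 ⟨d, by ring⟩)

theorem numbers_lt_succ_iff {a b : M} : a < b + 1 ↔ a ≤ b := by
  rw [ltIff, numbers_le_iff]
  exact exists_congr fun c => ⟨fun h => addCancel _ _ _ h, fun h => by rw [h]⟩

instance : IsOrderedCancelAddMonoid M where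
  add_le_add_left a b hab c := by
    obtain ⟨d, rfl⟩ := numbers_le_iff.1 hab
    exact numbers_le_iff.2 ⟨d, by ring⟩
  le_of_add_le_add_left a b c hab := by
    obtain ⟨d, hd⟩ := numbers_le_iff.1 hab
    exact numbers_le_iff.2 ⟨d, addCancel _ _ a (by rw [addComm c, hd]; ring)⟩

instance : CanonicallyOrderedAdd M where
  exists_add_of_le h := numbers_le_iff.1 h
  le_add_self a b := numbers_le_iff.2 ⟨b, by ring⟩
  le_self_add a b := numbers_le_iff.2 ⟨b, rfl⟩

instance : IsStrictOrderedRing M where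
  zero_le_one := zero_le
  exists_pair_ne := ⟨0, 1, fun e => by
    have : (0 : M) < 1 := (ltIff _ _).2 ⟨0, by ring⟩
    exact ltIrrefl _ (e ▸ this)⟩
  mul_lt_mul_of_pos_left a ha b c hbc := by
    obtain ⟨d, rfl⟩ := (ltIff _ _).1 ha
    obtain ⟨e, rfl⟩ := (ltIff _ _).1 hbc
    exact (ltIff _ _).2 ⟨d * e + d + e, by ring⟩
  mul_lt_mul_of_pos_right a ha b c hbc := by
    obtain ⟨d, rfl⟩ := (ltIff _ _).1 ha
    obtain ⟨e, rfl⟩ := (ltIff _ _).1 hbc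
    exact (ltIff _ _).2 ⟨d * e + d + e, by ring⟩

noncomputable instance : SuccAddOrder M where
  succ a := a + 1
  le_succ a := le_self_add
  max_of_succ_le {a} h := by
    exact absurd h (not_le.2 (numbers_lt_succ_iff.2 le_rfl))
  succ_le_of_lt {a b} h := by
    obtain ⟨d, rfl⟩ := (ltIff _ _).1 h
    exact numbers_le_iff.2 ⟨d, by ring⟩
  succ_eq_add_one _ := rfl

instance : NoMaxOrder M where
  exists_gt a := ⟨a + 1, numbers_lt_succ_iff.2 le_rfl⟩

end

section

variable {M : Type u} [L2 M] {S : Set (Set M)}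

/-! ## Substitution of terms -/

theorem IsTerm.shift {n : ℕ} (s : (Fin n → M) → M) [hs : IsTerm s] :
    IsTerm (fun w : Fin (n + 1) → M => s (fun i => w i.succ)) := by
  obtain ⟨N, a, σ, ha⟩ := hs
  refine ⟨N, a, fun i => (σ i).map Fin.succ id, fun v => ?_⟩
  rw [← ha]
  congr 1
  funext i
  rcases hi : σ i with j | c <;> simp [hi]

namespace Def0

/-- Terms are substituted without touching the syntax: P(s, t) is equivalent to the existence of x <
s + 1 and y < t + 1 with x = s, y = t and P(x, y), which involves only bounded quantifiers. -/
theorem comp₂ {P : Set M → M → M → Prop} (h : IsModelRCA0 M S)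
    (hP : Def0 S (fun X (w : Fin 2 → M) => P X (w 0) (w 1))) :
    ∀ ⦃n : ℕ⦄ (s t : (Fin n → M) → M) [IsTerm s] [IsTerm t],
      Def0 S (fun X v => P X (s v) (t v)) := by
  intro n s t _ _
  have : Def0 S (fun X (w : Fin (n + 1 + 1) → M) => P X (w (Fin.succ 0)) (w 0)) :=
    hP.subst ![.inl (Fin.succ 0), .inl 0]
  have := IsTerm.shift s
  have := IsTerm.shift t
  have := IsTerm.shift (fun w : Fin (n + 1) → M => t (fun i => w i.succ))
  refine (inferInstance : Def0 S (fun X (v : Fin n → M) =>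
    ∃ x, x < s v + 1 ∧ x = s v ∧ ∃ y, y < t v + 1 ∧ y = t v ∧ P X x y)).congr fun X v => ?_
  have h₁ := (h.lt_succ_iff (s v) (s v)).2 (.inr rfl)
  have h₂ := (h.lt_succ_iff (t v) (t v)).2 (.inr rfl)
  exact ⟨fun ⟨x, _, e, y, _, e', hx⟩ => e ▸ e' ▸ hx, fun hx => ⟨_, h₁, rfl, _, h₂, rfl, hx⟩⟩

theorem comp₃ {P : Set M → M → M → M → Prop} (h : IsModelRCA0 M S)
    (hP : Def0 S (fun X (w : Fin 3 → M) => P X (w 0) (w 1) (w 2))) :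
    ∀ ⦃n : ℕ⦄ (r s t : (Fin n → M) → M) [IsTerm r] [IsTerm s] [IsTerm t],
      Def0 S (fun X v => P X (r v) (s v) (t v)) := by
  intro n r s t _ _ _
  have : Def0 S (fun X (w : Fin (n + 1 + 1 + 1) → M) =>
      P X (w (Fin.succ (Fin.succ 0))) (w (Fin.succ 0)) (w 0)) :=
    hP.subst ![.inl (Fin.succ (Fin.succ 0)), .inl (Fin.succ 0), .inl 0]
  have := IsTerm.shift r
  have := IsTerm.shift s
  have := IsTerm.shift (fun w : Fin (n + 1) → M => s (fun i => w i.succ))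
  have := IsTerm.shift t
  have := IsTerm.shift (fun w : Fin (n + 1) → M => t (fun i => w i.succ))
  have := IsTerm.shift (fun w : Fin (n + 1 + 1) → M => t (fun i => w i.succ.succ))
  refine (inferInstance : Def0 S (fun X (v : Fin n → M) =>
    ∃ x, x < r v + 1 ∧ x = r v ∧ ∃ y, y < s v + 1 ∧ y = s v ∧
      ∃ z, z < t v + 1 ∧ z = t v ∧ P X x y z)).congr fun X v => ?_
  have h₀ := (h.lt_succ_iff (r v) (r v)).2 (.inr rfl)
  have h₁ := (h.lt_succ_iff (s v) (s v)).2 (.inr rfl)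
  have h₂ := (h.lt_succ_iff (t v) (t v)).2 (.inr rfl)
  exact ⟨fun ⟨x, _, e, y, _, e', z, _, e'', hx⟩ => e ▸ e' ▸ e'' ▸ hx,
    fun hx => ⟨_, h₀, rfl, _, h₁, rfl, _, h₂, rfl, hx⟩⟩

end Def0

variable [IsArith M]

instance Def0.le {n : ℕ} (s t : (Fin n → M) → M) [IsTerm s] [IsTerm t] :
    Def0 S (fun _ v => s v ≤ t v) :=
  (inferInstance : Def0 S (fun _ v => s v < t v ∨ s v = t v))

/-- The quotient can be bounded by the dividend; when the divisor is 0, so is the dividend, and 0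
serves as quotient. -/
instance Def0.dvd {n : ℕ} (s t : (Fin n → M) → M) [IsTerm s] [IsTerm t] :
    Def0 S (fun _ v => s v ∣ t v) := by
  have := IsTerm.shift s
  have := IsTerm.shift t
  refine (inferInstance : Def0 S (fun _ v => ∃ c, c < t v + 1 ∧ t v = s v * c)).congr
    fun X v => ⟨fun ⟨c, _, hc⟩ => ⟨c, hc⟩, fun ⟨c, hc⟩ => ?_⟩
  rcases eq_or_ne (s v) 0 with h | h
  · exact ⟨0, numbers_lt_succ_iff.2 zero_le, by rw [hc, h]; simp⟩
  · refine ⟨c, numbers_lt_succ_iff.2 ?_, hc⟩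
    rw [hc]
    exact le_mul_of_one_le_left zero_le (Order.one_le_iff_pos.2 (pos_iff_ne_zero.2 h))

/-! ## Pairs -/

theorem le_pair_left (a b : M) : a ≤ pair a b := le_add_self

theorem le_mul_self' (a : M) : a ≤ a * a := by
  rcases eq_or_ne a 0 with h | h
  · simp [h]
  · exact le_mul_of_one_le_left zero_le (Order.one_le_iff_pos.2 (pos_iff_ne_zero.2 h))

theorem le_pair_right (a b : M) : b ≤ pair a b :=
  le_add_self.trans ((le_mul_self' (a + b)).trans le_self_add)

theorem pair_mono {a b c d : M} (h₁ : a ≤ c) (h₂ : b ≤ d) : pair a b ≤ pair c d := by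
  unfold pair; gcongr

/-- The sum s = a + b can be read off because s² ≤ s² + a < (s + 1)². Once the sums agree,
cancellation yields both components. -/
theorem pair_inj {a b c d : M} : pair a b = pair c d ↔ a = c ∧ b = d := by
  refine ⟨fun h => ?_, fun ⟨h₁, h₂⟩ => by rw [h₁, h₂]⟩
  have key : ∀ {a b c d : M}, pair a b = pair c d → ¬ a + b < c + d := by
    intro a b c d h hlt
    obtain ⟨e, he⟩ := (IsArith.ltIff _ _).1 hlt
    have h₁ : a ≤ a + b := le_self_add
    have h₂ : (a + b) * (a + b) + a < (c + d) * (c + d) + c := by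
      rw [he]
      refine lt_of_le_of_lt (add_le_add_right h₁ _) (lt_of_lt_of_le ?_ le_self_add)
      refine (IsArith.ltIff _ _).2 ⟨(a + b) + (e + e) * (a + b) + e * e + e + e, ?_⟩
      ring
    exact h₂.ne h
  have hs : a + b = c + d := le_antisymm (not_lt.1 (key h.symm)) (not_lt.1 (key h))
  unfold pair at h
  rw [hs] at h
  have hac := add_left_cancel h
  rw [hac] at hs
  exact ⟨hac, add_left_cancel hs⟩

/-! ## Coding of bounded sets -/

theorem dvd_of_dvd_add {a b c : M} (h₁ : a ∣ b) (h₂ : a ∣ b + c) : a ∣ c := by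
  obtain ⟨x, rfl⟩ := h₁
  obtain ⟨y, hy⟩ := h₂
  rcases eq_or_ne a 0 with rfl | ha
  · simp only [zero_mul, zero_add] at hy
    simp [hy]
  · rcases le_total x y with h | h
    · obtain ⟨d, rfl⟩ := numbers_le_iff.1 h
      exact ⟨d, add_left_cancel (hy.trans (mul_add a x d))⟩
    · obtain ⟨d, rfl⟩ := numbers_le_iff.1 h
      rw [mul_add, add_assoc] at hy
      have : a * d + c = 0 := add_left_cancel (hy.trans (add_zero _).symm)
      rw [(add_eq_zero.1 this).2]
      exact dvd_zero a

/-- The moduli that are used to code sets. -/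
def modulus (b k : M) : M := 1 + (k + 1) * b

/-- The number `k` belongs to the bounded set that is coded by `a` and `b`. -/
def InCode (a b k : M) : Prop := modulus b k ∣ a

/-- The number `b` has all positive divisors up to `n`, so that it can be used to code subsets of
`{0, …, n - 1}`. -/
def Good (n b : M) : Prop := 0 < b ∧ ∀ k, k < n → k + 1 ∣ b

instance {n : ℕ} (s t : (Fin n → M) → M) [IsTerm s] [IsTerm t] :
    IsTerm (fun v => modulus (s v) (t v)) :=
  (inferInstance : IsTerm (fun v => 1 + (t v + 1) * s v))

instance {n : ℕ} (r s t : (Fin n → M) → M) [IsTerm r] [IsTerm s] [IsTerm t] :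
    Def0 S (fun _ v => InCode (r v) (s v) (t v)) :=
  (inferInstance : Def0 S (fun _ v => modulus (s v) (t v) ∣ r v))

theorem IsModelRCA0.exists_good (h : IsModelRCA0 M S) (n : M) : ∃ b, Good n b := by
  refine h.induction_ex (Q := fun b n => 0 < b ∧ ∀ k, k < n → k + 1 ∣ b) (by infer_instance)
    ⟨1, zero_lt_one, fun k hk => (_root_.not_lt_zero hk).elim⟩ (fun m ⟨b, hb, hm⟩ => ?_) n
  refine ⟨b * (m + 1), mul_pos hb (Order.lt_add_one_iff.2 zero_le), fun k hk => ?_⟩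
  rcases (h.lt_succ_iff _ _).1 hk with hk | rfl
  · exact (hm k hk).mul_right _
  · exact dvd_mul_left _ _

/-- This is coprimality of distinct moduli, phrased without subtraction. Combining (k + 1) times the
modulus of j with (j + 1) times the modulus of k leaves |j − k|, so the modulus of k divides |j − k|
· c. As |j − k| divides b, it divides (k + 1) · b · c as well, and it differs from 1 by just (k + 1)
· b. -/
theorem Good.dvd_of_dvd_mul {n b k j c : M} (hb : Good n b) (hk : k < n) (hj : j < n)
    (hkj : k ≠ j) (hc : modulus b k ∣ modulus b j * c) : modulus b k ∣ c := by
  have main : ∀ e, e < n → modulus b k ∣ (e + 1) * c → modulus b k ∣ c := by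
    intro e he hec
    obtain ⟨d, hd⟩ := hb.2 e he
    have h₁ : modulus b k ∣ (k + 1) * b * c := by
      have : (k + 1) * b * c = (e + 1) * c * ((k + 1) * d) := by rw [hd]; ring
      exact this ▸ hec.mul_right _
    refine dvd_of_dvd_add h₁ ⟨c, ?_⟩
    unfold modulus; ring
  rcases lt_or_gt_of_ne hkj with hlt | hlt
  · obtain ⟨e, rfl⟩ := (IsArith.ltIff _ _).1 hlt
    refine main e (lt_of_le_of_lt (le_add_self.trans le_self_add) hj) ?_
    refine dvd_of_dvd_add (hc.mul_left (k + 1)) ⟨(k + e + 1 + 1) * c, ?_⟩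
    unfold modulus; ring
  · obtain ⟨e, rfl⟩ := (IsArith.ltIff _ _).1 hlt
    refine main e (lt_of_le_of_lt (le_add_self.trans le_self_add) hk) ?_
    refine dvd_of_dvd_add (b := (j + 1) * c * modulus b (j + e + 1)) (dvd_mul_left _ _) ?_
    have := hc.mul_left (j + e + 1 + 1)
    convert this using 1
    unfold modulus; ring

theorem Good.inCode_mul {n b k z a : M} (hb : Good n b) (hk : k < n) (hz : z < n) :
    InCode (a * modulus b z) b k ↔ InCode a b k ∨ k = z := by
  constructor
  · intro h
    refine or_iff_not_imp_right.2 fun hkz => ?_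
    refine hb.dvd_of_dvd_mul hk hz hkz ?_
    rwa [mul_comm]
  · rintro (h | rfl)
    · exact Dvd.dvd.mul_right h _
    · exact dvd_mul_left _ _

theorem one_lt_modulus {b : M} (hb : 0 < b) (k : M) : 1 < modulus b k :=
  lt_add_of_pos_right _ (mul_pos (Order.lt_add_one_iff.2 zero_le) hb)

theorem not_inCode_one {b : M} (hb : 0 < b) (k : M) : ¬ InCode 1 b k := by
  rintro ⟨c, hc⟩
  have h1 := one_lt_modulus hb k
  rcases eq_or_ne c 0 with rfl | h
  · simp at hc
  · have : modulus b k ≤ modulus b k * c :=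
      le_mul_of_one_le_right zero_le (Order.one_le_iff_pos.2 (pos_iff_ne_zero.2 h))
    exact (h1.trans_le this).ne hc

/-! ## Collection and least number principles -/

namespace IsModelRCA0

/-- Without a least element one could descend forever: Σ⁰₁-induction on j yields an element that is
at most m − j, which is absurd for j = m + 1. -/
theorem least_sigma (h : IsModelRCA0 M S) {Q : M → M → Prop}
    (hQ : Def0 S (fun _ (w : Fin 2 → M) => Q (w 0) (w 1))) {m : M} (hm : ∃ x, Q x m) :
    ∃ k, (∃ x, Q x k) ∧ ∀ j, j < k → ∀ x, ¬ Q x j := by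
  by_contra! hcon
  have inst := Def0.comp₂ (P := fun _ => Q) h hQ
  have : ∃ x, ∃ k, k < m + 1 ∧ k + (m + 1) ≤ m ∧ Q x k := by
    refine h.induction_ex (Q := fun x j => ∃ k, k < m + 1 ∧ k + j ≤ m ∧ Q x k) inferInstance
      ?_ ?_ (m + 1)
    · obtain ⟨x, hx⟩ := hm
      exact ⟨x, m, Order.lt_add_one_iff.2 le_rfl, by simp, hx⟩
    · rintro j ⟨x, k, hk, hkj, hx⟩
      obtain ⟨k', hk', x', hx'⟩ := hcon k ⟨x, hx⟩
      refine ⟨x', k', hk'.trans hk, le_trans ?_ hkj, hx'⟩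
      rw [add_comm j, ← add_assoc]
      exact add_le_add_left (Order.add_one_le_iff.2 hk') _
  obtain ⟨x, k, -, hk, -⟩ := this
  exact absurd (le_add_self.trans hk) (not_le.2 (Order.lt_add_one_iff.2 le_rfl))

theorem least (h : IsModelRCA0 M S) {P : M → Prop}
    (hP : Def0 S (fun _ (w : Fin 1 → M) => P (w 0))) {m : M} (hm : P m) :
    ∃ k, P k ∧ ∀ j, j < k → ¬ P j := by
  obtain ⟨k, ⟨_, hk⟩, hj⟩ := h.least_sigma (Q := fun _ m => P m) (m := m)
    (hP.subst ![.inl (1 : Fin 2)]) ⟨0, hm⟩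
  exact ⟨k, hk, fun j hjk => hj j hjk 0⟩

/-- The common bound is built by Σ⁰₁-induction on the initial segment. The formula repeats the
condition k < n so that the induction can run over all numbers. -/
theorem collection (h : IsModelRCA0 M S) {Q : M → M → Prop}
    (hQ : Def0 S (fun _ (w : Fin 2 → M) => Q (w 0) (w 1))) {n : M}
    (hn : ∀ k, k < n → ∃ x, Q x k) : ∃ u, ∀ k, k < n → ∃ x, x < u ∧ Q x k := by
  have inst := Def0.comp₂ (P := fun _ => Q) h hQ
  have : ∃ u, ∀ k, k < n → k < n → ∃ x, x < u ∧ Q x k := by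
    refine h.induction_ex (Q := fun u j => ∀ k, k < j → k < n → ∃ x, x < u ∧ Q x k) inferInstance
      ⟨0, fun k hk => (_root_.not_lt_zero hk).elim⟩ (fun m ⟨u, hu⟩ => ?_) n
    by_cases hm : m < n
    · obtain ⟨x, hx⟩ := hn m hm
      refine ⟨u + (x + 1), fun k hk hkn => ?_⟩
      rcases (h.lt_succ_iff _ _).1 hk with hk | rfl
      · obtain ⟨y, hy, hyk⟩ := hu k hk hkn
        exact ⟨y, hy.trans_le le_self_add, hyk⟩
      · exact ⟨x, Order.lt_add_one_iff.2 le_rfl |>.trans_le le_add_self, hx⟩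
    · refine ⟨u, fun k hk hkn => ?_⟩
      rcases (h.lt_succ_iff _ _).1 hk with hk | rfl
      · exact hu k hk hkn
      · exact (hm hkn).elim
  exact this.imp fun u hu k hk => hu k hk hk

/-- If there were no least element, then Σ⁰₁-induction would produce a common bound on
counterexamples for all numbers up to m, by course-of-values reasoning, contrary to the choice of m.
-/
theorem least_pi (h : IsModelRCA0 M S) {Q : M → M → Prop}
    (hQ : Def0 S (fun _ (w : Fin 2 → M) => Q (w 0) (w 1))) {m : M} (hm : ∀ x, Q x m) :
    ∃ k, (∀ x, Q x k) ∧ ∀ j, j < k → ∃ x, ¬ Q x j := by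
  by_contra! hcon
  have inst := Def0.comp₂ (P := fun _ => Q) h hQ
  have : ∃ u, ∀ k, k < m + 1 → ∃ x, x < u ∧ ¬ Q x k := by
    refine h.induction_ex (Q := fun u j => ∀ k, k < j → ∃ x, x < u ∧ ¬ Q x k) inferInstance
      ⟨0, fun k hk => (_root_.not_lt_zero hk).elim⟩ (fun m ⟨u, hu⟩ => ?_) (m + 1)
    have hx : ∃ x, ¬ Q x m := by
      by_contra! hx
      obtain ⟨j, hj, hjx⟩ := hcon m hx
      obtain ⟨x, -, hx⟩ := hu j hj
      exact hx (hjx x)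
    obtain ⟨x, hx⟩ := hx
    refine ⟨u + (x + 1), fun k hk => ?_⟩
    rcases (h.lt_succ_iff _ _).1 hk with hk | rfl
    · obtain ⟨y, hy, hyk⟩ := hu k hk
      exact ⟨y, hy.trans_le le_self_add, hyk⟩
    · exact ⟨x, Order.lt_add_one_iff.2 le_rfl |>.trans_le le_add_self, hx⟩
  obtain ⟨u, hu⟩ := this
  obtain ⟨x, -, hx⟩ := hu m (Order.lt_add_one_iff.2 le_rfl)
  exact hx (hm x)

/-- Bounded `Σ⁰₁`-comprehension. -/
theorem exists_code (h : IsModelRCA0 M S) {Q : M → M → Prop}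
    (hQ : Def0 S (fun _ (w : Fin 2 → M) => Q (w 0) (w 1))) (n : M) :
    ∃ a b, ∀ k, k < n → (InCode a b k ↔ ∃ x, Q x k) := by
  have inst := Def0.comp₂ (P := fun _ => Q) h hQ
  obtain ⟨b, hb⟩ := h.exists_good n
  have hall : ∃ a, 0 < a ∧ ∀ k, k < n → InCode a b k := by
    refine h.induction_ex (Q := fun a j => 0 < a ∧ ∀ k, k < j → InCode a b k) inferInstance
      ⟨1, zero_lt_one, fun k hk => (_root_.not_lt_zero hk).elim⟩ (fun m ⟨a, ha, hm⟩ => ?_) n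
    refine ⟨a * modulus b m, mul_pos ha (zero_lt_one.trans (one_lt_modulus hb.1 m)),
      fun k hk => ?_⟩
    rcases (h.lt_succ_iff _ _).1 hk with hk | rfl
    · exact Dvd.dvd.mul_right (hm k hk) _
    · exact dvd_mul_left _ _
  obtain ⟨A, hA, hAn⟩ := hall
  -- To contain all k that have a witness is a Π⁰₁-condition on codes, and `A` satisfies it. A least
  -- such code contains nothing else, since a superfluous k could be removed by dividing by its
  -- modulus.
  obtain ⟨a, ha, hmin⟩ := h.least_pi
    (Q := fun x a => 0 < a ∧ ∀ k, k < n → Q x k → InCode a b k) inferInstance (m := A)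
    (fun x => ⟨hA, fun k hk _ => hAn k hk⟩)
  refine ⟨a, b, fun k hk => ⟨fun hak => ?_, fun ⟨x, hx⟩ => (ha x).2 k hk hx⟩⟩
  by_contra! hQk
  obtain ⟨c, rfl⟩ := id hak
  have hpos := (ha 0).1
  have hc : 0 < c := pos_iff_ne_zero.2 fun e => by simp [e] at hpos
  obtain ⟨x, hx⟩ := hmin c (lt_mul_of_one_lt_left hc (one_lt_modulus hb.1 k))
  refine hx ⟨hc, fun j hj hjx => ?_⟩
  have hjk : j ≠ k := fun e => hQk x (e ▸ hjx)
  exact hb.dvd_of_dvd_mul hj hk hjk ((ha x).2 j hj hjx)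

/-- Strong `Σ⁰₁`-collection. -/
theorem strong_collection (h : IsModelRCA0 M S) {Q : M → M → Prop}
    (hQ : Def0 S (fun _ (w : Fin 2 → M) => Q (w 0) (w 1))) (n : M) :
    ∃ u, ∀ k, k < n → (∃ x, Q x k) → ∃ x, x < u ∧ Q x k := by
  have inst := Def0.comp₂ (P := fun _ => Q) h hQ
  obtain ⟨a, b, hab⟩ := h.exists_code hQ n
  -- The code decides which k have a witness, so that the premise becomes bounded and ordinary
  -- collection suffices.
  obtain ⟨u, hu⟩ := h.collection (Q := fun x k => InCode a b k → Q x k) inferInstance (n := n)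
    (fun k hk => by
      by_cases hak : InCode a b k
      · exact ((hab k hk).1 hak).imp fun x hx _ => hx
      · exact ⟨0, fun h => (hak h).elim⟩)
  refine ⟨u, fun k hk hx => ?_⟩
  obtain ⟨x, hxu, hx'⟩ := hu k hk
  exact ⟨x, hxu, hx' ((hab k hk).2 hx)⟩

end IsModelRCA0

end

section

variable {M : Type u} [L2 M] {S : Set (Set M)} [IsArith M]

/-! ## Counting the elements of a set -/

/-- The numbers `a` and `b` code the graph of the function that counts the elements of `X` below
a given number, up to `y`. -/
def CountCode (X : Set M) (y a b : M) : Prop :=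
  (∀ j, j < y + 1 → (InCode a b (pair 0 j) ↔ j = 0)) ∧
  ∀ z, z < y → ∀ j, j < y + 1 → (InCode a b (pair (z + 1) j) ↔
    (z ∈ X ∧ ∃ i, i < j ∧ j = i + 1 ∧ InCode a b (pair z i)) ∨ (z ∉ X ∧ InCode a b (pair z j)))

/-- The set `X` has `j` elements below `y`, as witnessed by a code below `u`. -/
def CountBelow (X : Set M) (y j u : M) : Prop :=
  ∃ a, a < u ∧ ∃ b, b < u ∧ CountCode X y a b ∧ j < y + 1 ∧ InCode a b (pair y j)

/-- The set `X` has `j` elements below `y`. -/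
def Count (X : Set M) (y j : M) : Prop := ∃ u, CountBelow X y j u

theorem count_iff {X : Set M} {y j : M} :
    Count X y j ↔ ∃ a b, CountCode X y a b ∧ j ≤ y ∧ InCode a b (pair y j) := by
  constructor
  · rintro ⟨u, a, -, b, -, h, hj, hab⟩
    exact ⟨a, b, h, Order.lt_add_one_iff.1 hj, hab⟩
  · rintro ⟨a, b, h, hj, hab⟩
    exact ⟨a + b + 1, a, Order.lt_add_one_iff.2 le_self_add, b,
      Order.lt_add_one_iff.2 le_add_self, h, Order.lt_add_one_iff.2 hj, hab⟩

instance def0_countCode {n : ℕ} (i j k : Fin n) :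
    Def0 S (fun X v => CountCode X (v i) (v j) (v k)) := by
  unfold CountCode; infer_instance

theorem def0_countBelow :
    Def0 S (fun X (w : Fin 3 → M) => CountBelow X (w 0) (w 1) (w 2)) := by
  unfold CountBelow; infer_instance

variable {X : Set M}

/-- The table of the counting function is built row by row; a new entry is added by multiplication
with its modulus. The parameter b is fixed in advance, large enough for all pairs up to (y, y). -/
theorem IsModelRCA0.exists_countCode (h : IsModelRCA0 M S) (hX : X ∈ S) (y : M) :
    ∃ a b, CountCode X y a b := by
  have : Fact (X ∈ S) := ⟨hX⟩
  obtain ⟨b, hb⟩ := h.exists_good (pair y y + 1)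
  have lt : ∀ {z j}, z ≤ y → j < y + 1 → pair z j < pair y y + 1 := fun hz hj =>
    Order.lt_add_one_iff.2 (pair_mono hz (Order.lt_add_one_iff.1 hj))
  suffices ∃ a, y ≤ y → ∃ i, i < y + 1 ∧ (∀ j, j < y + 1 → (InCode a b (pair 0 j) ↔ j = 0)) ∧
      (∀ z, z < y → ∀ j, j < y + 1 → (InCode a b (pair (z + 1) j) ↔
        (z ∈ X ∧ ∃ i, i < j ∧ j = i + 1 ∧ InCode a b (pair z i)) ∨
          (z ∉ X ∧ InCode a b (pair z j)))) ∧
      (∀ z, z < y + 1 → ∀ j, j < y + 1 → InCode a b (pair z j) → z ≤ y) ∧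
      (∀ j, j < y + 1 → (InCode a b (pair y j) ↔ j = i)) by
    obtain ⟨a, ha⟩ := this
    obtain ⟨i, -, h₁, h₂, -⟩ := ha le_rfl
    exact ⟨a, b, h₁, h₂⟩
  -- The clause that no entry lies in a row above m ensures that the row added next holds exactly
  -- one number.
  refine h.induction_ex (Q := fun a m => m ≤ y → ∃ i, i < m + 1 ∧
      (∀ j, j < y + 1 → (InCode a b (pair 0 j) ↔ j = 0)) ∧
      (∀ z, z < m → ∀ j, j < y + 1 → (InCode a b (pair (z + 1) j) ↔
        (z ∈ X ∧ ∃ i, i < j ∧ j = i + 1 ∧ InCode a b (pair z i)) ∨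
          (z ∉ X ∧ InCode a b (pair z j)))) ∧
      (∀ z, z < y + 1 → ∀ j, j < y + 1 → InCode a b (pair z j) → z ≤ m) ∧
      (∀ j, j < y + 1 → (InCode a b (pair m j) ↔ j = i))) (by infer_instance) ?_ ?_ y
  · have key : ∀ z j, z ≤ y → j < y + 1 →
        (InCode (1 * modulus b (pair 0 0)) b (pair z j) ↔ z = 0 ∧ j = 0) := by
      intro z j hz hj
      rw [hb.inCode_mul (lt hz hj) (lt zero_le (Order.lt_add_one_iff.2 zero_le)), pair_inj]
      exact or_iff_right (not_inCode_one hb.1 _)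
    refine ⟨1 * modulus b (pair 0 0), fun _ => ⟨0, Order.lt_add_one_iff.2 le_rfl,
      fun j hj => ?_, fun z hz => (_root_.not_lt_zero hz).elim, fun z hz j hj hzj => ?_, fun j hj => ?_⟩⟩
    · rw [key 0 j zero_le hj]; simp
    · exact ((key z j (Order.lt_add_one_iff.1 hz) hj).1 hzj).1.le
    · rw [key 0 j zero_le hj]; simp
  · rintro m ⟨a, ha⟩
    by_cases hm : m + 1 ≤ y
    swap
    · exact ⟨0, fun h => (hm h).elim⟩
    have hmy : m < y := Order.add_one_le_iff.1 hm
    obtain ⟨i, hi, h₁, h₂, h₃, h₄⟩ := ha hmy.le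
    have hiy : i < y + 1 := hi.trans_le (add_le_add_left hmy.le 1)
    obtain ⟨i', hi', hi'm⟩ : ∃ i', i' < m + 1 + 1 ∧
        ((m ∈ X ∧ i' = i + 1) ∨ (m ∉ X ∧ i' = i)) := by
      by_cases hmX : m ∈ X
      · exact ⟨i + 1, add_lt_add_left hi 1, .inl ⟨hmX, rfl⟩⟩
      · exact ⟨i, hi.trans (Order.lt_add_one_iff.2 le_rfl), .inr ⟨hmX, rfl⟩⟩
    have hi'y : i' < y + 1 := hi'.trans_le (add_le_add_left hm 1)
    have key : ∀ z j, z ≤ y → j < y + 1 → (InCode (a * modulus b (pair (m + 1) i')) b (pair z j) ↔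
        InCode a b (pair z j) ∨ (z = m + 1 ∧ j = i')) := by
      intro z j hz hj
      rw [hb.inCode_mul (lt hz hj) (lt hm hi'y), pair_inj]
    have hlt : m < m + 1 := Order.lt_add_one_iff.2 le_rfl
    have keep : ∀ z j, z ≤ m → j < y + 1 →
        (InCode (a * modulus b (pair (m + 1) i')) b (pair z j) ↔ InCode a b (pair z j)) := by
      intro z j hz hj
      rw [key z j (hz.trans hmy.le) hj]
      exact or_iff_left fun e => absurd (e.1 ▸ hz) (not_le.2 hlt)
    have new : ∀ j, j < y + 1 →
        (InCode (a * modulus b (pair (m + 1) i')) b (pair (m + 1) j) ↔ j = i') := by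
      intro j hj
      rw [key _ j hm hj]
      refine ⟨?_, fun e => .inr ⟨rfl, e⟩⟩
      rintro (e | e)
      · exact absurd (h₃ _ (Order.lt_add_one_iff.2 hm) j hj e) (not_le.2 hlt)
      · exact e.2
    refine ⟨a * modulus b (pair (m + 1) i'), fun _ => ⟨i', hi', fun j hj => ?_,
      fun z hz j hj => ?_, fun z hz j hj hzj => ?_, new⟩⟩
    · rw [keep 0 j zero_le hj, h₁ j hj]
    · have hz' := Order.lt_add_one_iff.1 hz
      rw [keep z j hz' hj]
      have hk : (∃ i, i < j ∧ j = i + 1 ∧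
          InCode (a * modulus b (pair (m + 1) i')) b (pair z i)) ↔
          ∃ i, i < j ∧ j = i + 1 ∧ InCode a b (pair z i) := by
        refine exists_congr fun i => and_congr_right fun hij => and_congr_right fun _ => ?_
        exact keep z i hz' (hij.trans hj)
      rw [hk]
      rcases eq_or_lt_of_le hz' with rfl | hlt'
      · rw [new j hj, h₄ j hj]
        have : (∃ k, k < j ∧ j = k + 1 ∧ InCode a b (pair z k)) ↔ j = i + 1 := by
          constructor
          · rintro ⟨k, hk, rfl, hk'⟩
            rw [(h₄ k (hk.trans hj)).1 hk']
          · rintro rfl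
            exact ⟨i, Order.lt_add_one_iff.2 le_rfl, rfl, (h₄ i hiy).2 rfl⟩
        rw [this]
        rcases hi'm with ⟨hz, rfl⟩ | ⟨hz, rfl⟩ <;> simp [hz]
      · rw [keep (z + 1) j (Order.add_one_le_iff.2 hlt') hj]
        exact h₂ z hlt' j hj
    · rcases (key z j (Order.lt_add_one_iff.1 hz) hj).1 hzj with h | h
      · exact (h₃ z hz j hj h).trans hlt.le
      · exact h.1.le

/-- Two tables, possibly of different size, satisfy the same recursion and so agree row by row.
Hence the count does not depend on the chosen code. -/
theorem IsModelRCA0.countCode_unique (h : IsModelRCA0 M S) (hX : X ∈ S) {y y' a b a' b' : M}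
    (hy : y ≤ y') (hab : CountCode X y a b) (hab' : CountCode X y' a' b') :
    ∃ i, i ≤ y ∧ (∀ j, j ≤ y → (InCode a b (pair y j) ↔ j = i)) ∧
      ∀ j, j ≤ y' → (InCode a' b' (pair y j) ↔ j = i) := by
  have : Fact (X ∈ S) := ⟨hX⟩
  have : y ≤ y → ∃ i, i < y + 1 ∧ (∀ j, j < y + 1 → (InCode a b (pair y j) ↔ j = i)) ∧
      ∀ j, j < y' + 1 → (InCode a' b' (pair y j) ↔ j = i) := by
    refine h.induction (P := fun z => z ≤ y → ∃ i, i < z + 1 ∧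
      (∀ j, j < y + 1 → (InCode a b (pair z j) ↔ j = i)) ∧
      ∀ j, j < y' + 1 → (InCode a' b' (pair z j) ↔ j = i)) (by infer_instance)
      (fun _ => ⟨0, Order.lt_add_one_iff.2 le_rfl, hab.1, hab'.1⟩) (fun z ih hz => ?_) y
    have hzy : z < y := Order.add_one_le_iff.1 hz
    obtain ⟨i, hi, h₁, h₂⟩ := ih hzy.le
    have step : ∀ {y a b : M}, z < y → CountCode X y a b →
        (∀ j, j < y + 1 → (InCode a b (pair z j) ↔ j = i)) → ∀ j, j < y + 1 →
        (InCode a b (pair (z + 1) j) ↔ (z ∈ X ∧ j = i + 1) ∨ (z ∉ X ∧ j = i)) := by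
      intro y a b hz hab h₁ j hj
      rw [hab.2 z hz j hj, h₁ j hj]
      have : (∃ k, k < j ∧ j = k + 1 ∧ InCode a b (pair z k)) ↔ j = i + 1 := by
        constructor
        · rintro ⟨k, hk, rfl, hk'⟩
          rw [(h₁ k (hk.trans hj)).1 hk']
        · rintro rfl
          have : i < i + 1 := Order.lt_add_one_iff.2 le_rfl
          exact ⟨i, this, rfl, (h₁ i (this.trans hj)).2 rfl⟩
      rw [this]
    have s₁ := step hzy hab h₁
    have s₂ := step (hzy.trans_le hy) hab' h₂
    by_cases hzX : z ∈ X
    · exact ⟨i + 1, add_lt_add_left hi 1, by simpa [hzX] using s₁, by simpa [hzX] using s₂⟩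
    · exact ⟨i, hi.trans (Order.lt_add_one_iff.2 le_rfl), by simpa [hzX] using s₁,
        by simpa [hzX] using s₂⟩
  simpa only [Order.lt_add_one_iff] using this le_rfl

/-- The model has, for each of its sets, the function that counts the elements of the set. -/
theorem IsModelRCA0.exists_count (h : IsModelRCA0 M S) (hX : X ∈ S) : ∃ f : M → M, (∀ y, f y ≤ y) ∧
    (∀ y, y ∈ X → f (y + 1) = f y + 1) ∧ (∀ y, y ∉ X → f (y + 1) = f y) ∧
    (∀ y j, Count X y j ↔ j = f y) ∧
    Def0 S (fun _ (w : Fin 2 → M) => w 1 = f (w 0)) := by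
  have ex : ∀ y, ∃ i, (∀ j, Count X y j ↔ j = i) ∧
      ∀ a b y', y ≤ y' → CountCode X y' a b → ∀ j, j ≤ y' → (InCode a b (pair y j) ↔ j = i) := by
    intro y
    obtain ⟨a, b, hab⟩ := h.exists_countCode hX y
    obtain ⟨i, hi, h₁, -⟩ := h.countCode_unique hX le_rfl hab hab
    have key : ∀ a b y', y ≤ y' → CountCode X y' a b →
        ∀ j, j ≤ y' → (InCode a b (pair y j) ↔ j = i) := by
      intro a' b' y' hy hab' j hj
      obtain ⟨i', hi', h₁', h₂'⟩ := h.countCode_unique hX hy hab hab'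
      rw [h₂' j hj, (h₁' i hi).1 ((h₁ i hi).2 rfl)]
    refine ⟨i, fun j => ?_, key⟩
    rw [count_iff]
    constructor
    · rintro ⟨a, b, hab, hj, hin⟩
      exact (key a b y le_rfl hab j hj).1 hin
    · rintro rfl
      exact ⟨a, b, hab, hi, (h₁ _ hi).2 rfl⟩
  choose f hf hf' using ex
  have hle : ∀ y, f y ≤ y := fun y => by
    obtain ⟨a, b, -, hj, -⟩ := count_iff.1 ((hf y _).2 rfl)
    exact hj
  have hlt : ∀ y : M, y < y + 1 := fun y => Order.lt_add_one_iff.2 le_rfl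
  have step : ∀ y j, j ≤ y + 1 → (j = f (y + 1) ↔ (y ∈ X ∧ j = f y + 1) ∨ (y ∉ X ∧ j = f y)) := by
    intro y j hj
    obtain ⟨a, b, hab⟩ := h.exists_countCode hX (y + 1)
    rw [← hf' (y + 1) a b (y + 1) le_rfl hab j hj, hab.2 y (hlt y) j (Order.lt_add_one_iff.2 hj),
      hf' y a b (y + 1) (hlt y).le hab j hj]
    have : (∃ k, k < j ∧ j = k + 1 ∧ InCode a b (pair y k)) ↔ j = f y + 1 := by
      constructor
      · rintro ⟨k, hk, rfl, hk'⟩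
        rw [(hf' y a b (y + 1) (hlt y).le hab k (hk.le.trans hj)).1 hk']
      · rintro rfl
        exact ⟨f y, hlt _, rfl, (hf' y a b (y + 1) (hlt y).le hab _ ((hlt _).le.trans hj)).2 rfl⟩
    rw [this]
  -- The graph of the count is Δ⁰₁: some table yields j or, equivalently by uniqueness, every count
  -- that a table yields equals j.
  have hdef : {m | ∃ u, ∃ y, y < m + 1 ∧ ∃ j, j < m + 1 ∧ m = pair y j ∧ CountBelow X y j u} ∈
      S := by
    have := ((def0_countBelow (S := S)).inst hX).comp₃ (P := fun _ => CountBelow X) h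
    refine h.comprehension
      (Q := fun u m => ∃ y, y < m + 1 ∧ ∃ j, j < m + 1 ∧ m = pair y j ∧ CountBelow X y j u)
      (R := fun u m => ∃ y, y < m + 1 ∧ ∃ j, j < m + 1 ∧ m = pair y j ∧
        ∀ i, i < u → ∀ u', u' < u → CountBelow X y i u' → i = j) (by infer_instance)
      (by infer_instance) fun m => ?_
    constructor
    · rintro ⟨u, y, hy, j, hj, rfl, hu⟩ u₁
      refine ⟨y, hy, j, hj, rfl, fun i _ u' _ hi => ?_⟩
      rw [(hf y i).1 ⟨u', hi⟩, (hf y j).1 ⟨u, hu⟩]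
    · intro H
      obtain ⟨y, hy, j, hj, rfl, -⟩ := H 0
      obtain ⟨u, hu⟩ := (hf y _).2 rfl
      obtain ⟨y', -, j', -, he, H⟩ := H (f y + u + 1)
      obtain ⟨rfl, rfl⟩ := pair_inj.1 he
      have := H (f y) (Order.lt_add_one_iff.2 le_self_add) u (Order.lt_add_one_iff.2 le_add_self) hu
      exact ⟨u, y, hy, j, hj, rfl, this ▸ hu⟩
  refine ⟨f, hle, fun y hy => ?_, fun y hy => ?_, hf, ?_⟩
  · refine ((step y (f y + 1) (add_le_add_left (hle y) 1)).2 (.inl ⟨hy, rfl⟩)).symm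
  · exact ((step y (f y) ((hle y).trans (hlt y).le)).2 (.inr ⟨hy, rfl⟩)).symm
  · have : Fact (_ ∈ S) := ⟨hdef⟩
    refine (inferInstance : Def0 S (fun _ (w : Fin 2 → M) => pair (w 0) (w 1) ∈
      {m | ∃ u, ∃ y, y < m + 1 ∧ ∃ j, j < m + 1 ∧ m = pair y j ∧ CountBelow X y j u})).congr
      fun _ w => ?_
    rw [← hf]
    constructor
    · rintro ⟨u, y, -, j, -, he, hu⟩
      obtain ⟨h₁, h₂⟩ := pair_inj.1 he
      exact ⟨u, h₁ ▸ h₂ ▸ hu⟩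
    · rintro ⟨u, hu⟩
      exact ⟨u, _, Order.lt_add_one_iff.2 (le_pair_left _ _), _,
        Order.lt_add_one_iff.2 (le_pair_right _ _), rfl, hu⟩

end

section

variable {M : Type u} [L2 M] {S : Set (Set M)}

/-! ## Relations defined by `Σ⁰₂`-formulas -/

theorem Def0.exists_sigma2Graph {D : Set M → M → M → M → Prop}
    (hD : Def0 S (fun X (w : Fin 3 → M) => D X (w 0) (w 1) (w 2))) {B : Set M} (hB : B ∈ S) :
    ∃ (k n : ℕ) (θ : BddFormula (k + 1) (n + 3)) (P : Fin k → Set M) (v : Fin n → M),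
      (∀ i, P i ∈ S) ∧ ∀ X q, Sigma2Graph θ P v X q ↔ ∃ x, ∀ y, D X y x q := by
  obtain ⟨k, N, A, p, hA, hθ⟩ := hD.exists_formula hB
  obtain ⟨θ, hθ⟩ := hθ (N + 3) ![0, 1, 2] (fun i => i.succ.succ.succ)
  refine ⟨k, N, θ, A, p, hA, fun X q => exists_congr fun x => forall_congr' fun y => ?_⟩
  simpa using hθ X (Matrix.vecCons y (Matrix.vecCons x (Matrix.vecCons q p))) (fun i => by simp)

theorem BddFormula.def0_holds {k n : ℕ} (θ : BddFormula (k + 1) (n + 3)) (P : Fin k → Set M)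
    (v : Fin n → M) (hP : ∀ i, P i ∈ S) :
    Def0 S (fun X (w : Fin 3 → M) => θ.Holds (Matrix.vecCons X P)
      (Matrix.vecCons (w 0) (Matrix.vecCons (w 1) (Matrix.vecCons (w 2) v)))) := by
  refine ⟨k + 1, n + 3, θ, Matrix.vecCons none (fun i => some (P i)),
    Matrix.vecCons (.inl 0) (Matrix.vecCons (.inl 1) (Matrix.vecCons (.inl 2) (fun i => .inr (v i)))),
    ?_, fun X w => ?_⟩
  · refine Fin.cases (fun B hB => by simp at hB) (fun i B hB => ?_)
    simp only [Matrix.cons_val_succ, Option.mem_def, Option.some.injEq] at hB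
    exact hB ▸ hP i
  · have h₁ : (fun i => (Matrix.vecCons none (fun i => some (P i)) i : Option (Set M)).getD X) =
        Matrix.vecCons X P := by
      funext i
      refine Fin.cases ?_ (fun i => ?_) i <;> simp
    have h₂ : (fun i => Sum.elim w id ((Matrix.vecCons (.inl 0) (Matrix.vecCons (.inl 1)
        (Matrix.vecCons (.inl 2) (fun i => .inr (v i)))) : Fin (n + 3) → Fin 3 ⊕ M) i)) =
        Matrix.vecCons (w 0) (Matrix.vecCons (w 1) (Matrix.vecCons (w 2) v)) := by
      funext i
      refine Fin.cases rfl (fun i => Fin.cases rfl (fun i => Fin.cases rfl (fun i => ?_) i) i) i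
      simp
    rw [h₁, h₂]

variable [IsArith M]

/-! ## Final segments of infinite sets -/

/-- The final segment of `X` that starts at `z`. -/
def above (X : Set M) (z : M) : Set M := {x | x ∈ X ∧ ¬ x < z}

/-- The number `z'` is the next element of `X` after `z`. -/
def Next (X : Set M) (z z' : M) : Prop := z < z' ∧ z' ∈ X ∧ ∀ t, t < z' → z < t → t ∉ X

theorem mem_above {X : Set M} {x z : M} : x ∈ above X z ↔ x ∈ X ∧ z ≤ x := by
  simp [above]

theorem above_above {X : Set M} {z z' : M} (h : z ≤ z') : above (above X z) z' = above X z' := by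
  ext x
  simp only [mem_above]
  exact ⟨fun h' => ⟨h'.1.1, h'.2⟩, fun h' => ⟨⟨h'.1, h.trans h'.2⟩, h'.2⟩⟩

theorem above_eq_self {X : Set M} {z : M} (h : ∀ x, x ∈ X → z ≤ x) : above X z = X := by
  ext x
  rw [mem_above]
  exact ⟨fun h' => h'.1, fun h' => ⟨h', h x h'⟩⟩

theorem Next.le {X : Set M} {z z' t : M} (h : Next X z z') (ht : t ∈ X) (hz : z < t) : z' ≤ t :=
  not_lt.1 fun h' => h.2.2 t h' hz ht

theorem Next.unique {X : Set M} {z z' z'' : M} (h : Next X z z') (h' : Next X z z'') : z' = z'' :=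
  le_antisymm (h.le h'.2.1 h'.1) (h'.le h.2.1 h.1)

theorem Next.tail_above {X : Set M} {z z' : M} (hz : z ∈ X) (h : Next X z z') :
    tail (above X z) = above X z' := by
  ext x
  simp only [tail, mem_above, Set.mem_ofPred_eq]
  constructor
  · rintro ⟨⟨hx, -⟩, m, ⟨-, hm⟩, hmx⟩
    exact ⟨hx, h.le hx (hm.trans_lt hmx)⟩
  · rintro ⟨hx, hzx⟩
    exact ⟨⟨hx, h.1.le.trans hzx⟩, z, ⟨hz, le_rfl⟩, h.1.trans_le hzx⟩

theorem IsInf.above {X : Set M} (h : IsInf X) (z : M) : IsInf (above X z) := by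
  intro n
  obtain ⟨m, hm, hnm⟩ := h (n + z)
  exact ⟨m, mem_above.2 ⟨hm, le_add_self.trans hnm.le⟩, le_self_add.trans_lt hnm⟩

instance def0_next {n : ℕ} (i j : Fin n) : Def0 S (fun X v => Next X (v i) (v j)) := by
  unfold Next; infer_instance

namespace IsModelRCA0

theorem above_mem (h : IsModelRCA0 M S) {X : Set M} (hX : X ∈ S) (z : M) : above X z ∈ S := by
  have : Fact (X ∈ S) := ⟨hX⟩
  exact h.def0_mem (P := fun x => x ∈ X ∧ ¬ x < z) inferInstance

theorem exists_min (h : IsModelRCA0 M S) {X : Set M} (hX : X ∈ S) (hi : IsInf X) :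
    ∃ z, z ∈ X ∧ ∀ x, x ∈ X → z ≤ x := by
  have : Fact (X ∈ S) := ⟨hX⟩
  obtain ⟨m, hm, -⟩ := hi 0
  obtain ⟨k, hk, hmin⟩ := h.least (P := fun x => x ∈ X) inferInstance hm
  exact ⟨k, hk, fun x hx => not_lt.1 fun hlt => hmin x hlt hx⟩

theorem exists_next (h : IsModelRCA0 M S) {X : Set M} (hX : X ∈ S) (hi : IsInf X) (z : M) :
    ∃ z', Next X z z' := by
  obtain ⟨k, hk, hmin⟩ := h.exists_min (h.above_mem hX (z + 1)) (hi.above (z + 1))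
  rw [mem_above, Order.add_one_le_iff] at hk
  refine ⟨k, hk.2, hk.1, fun t ht hzt htX => ?_⟩
  exact absurd (hmin t (mem_above.2 ⟨htX, Order.add_one_le_iff.2 hzt⟩)) (not_le.2 ht)

theorem count_eq_zero (h : IsModelRCA0 M S) {X : Set M} {f : M → M} (hf₀ : ∀ y, f y ≤ y)
    (hf₁ : ∀ y, y ∉ X → f (y + 1) = f y)
    (hf : Def0 S (fun _ (w : Fin 2 → M) => w 1 = f (w 0))) {x : M} (hx : ∀ z, z ∈ X → x ≤ z) :
    f x = 0 := by
  have := hf.comp₂ (P := fun _ y j => j = f y) h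
  refine (h.induction (P := fun y => y ≤ x → 0 = f y) inferInstance (fun _ => ?_)
    (fun m ih hm => ?_) x le_rfl).symm
  · exact ((hf₀ 0).antisymm zero_le).symm
  · have hmx := Order.add_one_le_iff.1 hm
    rw [hf₁ m fun hmX => absurd (hx m hmX) (not_le.2 hmx)]
    exact ih hmx.le

theorem even_or_odd (h : IsModelRCA0 M S) (j : M) :
    (∃ k, k < j ∧ j = k + k + 1) ∨ ∃ k, k < j + 1 ∧ j = k + k := by
  refine h.induction (P := fun j => (∃ k, k < j ∧ j = k + k + 1) ∨ ∃ k, k < j + 1 ∧ j = k + k)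
    (by infer_instance) (.inr ⟨0, Order.lt_add_one_iff.2 le_rfl, by simp⟩) (fun m hm => ?_) j
  rcases hm with ⟨k, hk, rfl⟩ | ⟨k, hk, rfl⟩
  · refine .inr ⟨k + 1, add_lt_add_left (hk.trans (Order.lt_add_one_iff.2 le_rfl)) 1, ?_⟩
    ac_rfl
  · exact .inl ⟨k, hk, rfl⟩

end IsModelRCA0

theorem add_self_ne_succ (k l : M) : k + k ≠ l + l + 1 := by
  intro e
  rcases le_or_gt k l with hkl | hkl
  · exact absurd (add_le_add hkl hkl) (not_le.2 (e ▸ Order.lt_add_one_iff.2 le_rfl))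
  · have h₁ : l + 1 + (l + 1) ≤ k + k :=
      add_le_add (Order.add_one_le_iff.2 hkl) (Order.add_one_le_iff.2 hkl)
    have h₂ : l + l + 1 < l + 1 + (l + 1) := by
      have : l + 1 + (l + 1) = l + l + 1 + 1 := by ac_rfl
      exact this ▸ Order.lt_add_one_iff.2 le_rfl
    exact h₂.not_ge (e ▸ h₁)

/-! ## Colourings with three colours -/

/-- The number `m` is the first element of `X` at which the label `L` of the final segments of `X`
changes. -/
def FirstChange (L : Set M → Prop) (X : Set M) (m : M) : Prop :=
  m ∈ X ∧ ¬ (L (above X m) ↔ L X) ∧ ∀ z, z ∈ X → z < m → (L (above X z) ↔ L X)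

theorem FirstChange.unique {L : Set M → Prop} {X : Set M} {m m' : M} (h : FirstChange L X m)
    (h' : FirstChange L X m') : m = m' := by
  rcases lt_trichotomy m m' with hlt | he | hlt
  · exact (h.2.1 (h'.2.2 m h.1 hlt)).elim
  · exact he
  · exact (h'.2.1 (h.2.2 m' h'.1 hlt)).elim

/-- The number `d` codes the label of `X`. -/
def HasLabel (L : Set M → Prop) (X : Set M) (d : M) : Prop := (d = 1 ∧ L X) ∨ (d = 0 ∧ ¬ L X)

/-- The colour `q` of a set with label `d` that has `j` elements below the first change. -/
def Colour (d j q : M) : Prop :=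
  (∃ k, k < j ∧ j = k + k + 1 ∧ q = d) ∨ ∃ k, k < j + 1 ∧ j = k + k ∧ q = 1 + 1

theorem zero_ne_two : (0 : M) ≠ 1 + 1 := (add_pos one_pos one_pos).ne

theorem one_ne_two : (1 : M) ≠ 1 + 1 := (lt_add_one (1 : M)).ne

theorem Colour.unique {d j p q : M} (hp : Colour d j p) (hq : Colour d j q) : p = q := by
  rcases hp with ⟨k, -, rfl, rfl⟩ | ⟨k, -, rfl, rfl⟩ <;>
  rcases hq with ⟨l, -, h, rfl⟩ | ⟨l, -, h, rfl⟩
  · rfl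
  · exact (add_self_ne_succ _ _ h.symm).elim
  · exact (add_self_ne_succ _ _ h).elim
  · rfl

theorem Colour.of_one {d p : M} (hp : Colour d 1 p) : p = d := by
  rcases hp with ⟨k, -, -, rfl⟩ | ⟨k, -, h, -⟩
  · rfl
  · refine (add_self_ne_succ k 0 ?_).elim
    rw [← h]; simp

/-- The parity changes from j to j + 1, and exactly one of the two colours is the label, which is
not 2. -/
theorem Colour.not_succ {d j p : M} (hd : d ≠ 1 + 1) (hp : Colour d (j + 1) p) :
    ¬ Colour d j p := by
  intro hq
  rcases hp with ⟨k, -, hk, rfl⟩ | ⟨k, -, hk, rfl⟩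
  · rcases hq with ⟨l, -, rfl, -⟩ | ⟨l, -, -, h⟩
    · exact add_self_ne_succ _ _ (add_right_cancel hk).symm
    · exact hd h
  · rcases hq with ⟨l, -, -, h⟩ | ⟨l, -, rfl, -⟩
    · exact hd h.symm
    · exact add_self_ne_succ _ _ hk.symm

theorem HasLabel.ne_two {L : Set M → Prop} {X : Set M} {d : M} (h : HasLabel L X d) :
    d ≠ 1 + 1 := by
  rcases h with ⟨rfl, -⟩ | ⟨rfl, -⟩
  exacts [one_ne_two, zero_ne_two]

theorem HasLabel.eq_iff {L : Set M → Prop} {X Y : Set M} {d e : M} (h : HasLabel L X d)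
    (h' : HasLabel L Y e) : d = e ↔ (L X ↔ L Y) := by
  rcases h with ⟨rfl, h⟩ | ⟨rfl, h⟩ <;> rcases h' with ⟨rfl, h'⟩ | ⟨rfl, h'⟩ <;> simp [h, h']

theorem Colour.mem_three {L : Set M → Prop} {X : Set M} {d j q : M} (h : HasLabel L X d)
    (hq : Colour d j q) : q ∈ (three M).carrier := by
  rcases hq with ⟨k, -, -, rfl⟩ | ⟨k, -, -, rfl⟩
  · rcases h with ⟨rfl, -⟩ | ⟨rfl, -⟩ <;> simp [three]
  · simp [three]

/-- The colour of `X` with respect to the label `L`: along each run of final segments with the same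
label, the label alternates with a third colour. -/
def ThreeGraph (L : Set M → Prop) (X : Set M) (q : M) : Prop :=
  ∃ m j d, HasLabel L X d ∧ FirstChange L X m ∧ Count X m j ∧ Colour d j q

/-- The first change, the count below it and the label are each unique, and every number is even or
odd, but not both. -/
theorem isFunctionTo_three (h : IsModelRCA0 M S) {L : Set M → Prop} {G : Set M → M → Prop}
    (hG : ∀ X, X ∈ S → IsInf X → ∀ q, G X q ↔ ThreeGraph L X q)
    (hL : ∀ X, X ∈ S → IsInf X → ∃ m, FirstChange L X m) : IsFunctionTo S (three M) G := by
  intro X hX hi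
  obtain ⟨m, hm⟩ := hL X hX hi
  obtain ⟨f, -, -, -, hf, -⟩ := h.exists_count hX
  obtain ⟨d, hd⟩ : ∃ d, HasLabel L X d := by
    by_cases hLX : L X
    · exact ⟨1, .inl ⟨rfl, hLX⟩⟩
    · exact ⟨0, .inr ⟨rfl, hLX⟩⟩
  obtain ⟨q, hq⟩ : ∃ q, Colour d (f m) q := by
    rcases h.even_or_odd (f m) with ⟨k, hk, he⟩ | ⟨k, hk, he⟩
    · exact ⟨d, .inl ⟨k, hk, he, rfl⟩⟩
    · exact ⟨1 + 1, .inr ⟨k, hk, he, rfl⟩⟩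
  refine ⟨q, hq.mem_three hd, fun q' => ?_⟩
  rw [hG X hX hi]
  constructor
  · rintro ⟨m', j, d', hd', hm', hj, hq'⟩
    obtain rfl := hm'.unique hm
    rw [hf] at hj
    rw [(hd'.eq_iff hd).2 Iff.rfl, hj] at hq'
    exact hq'.unique hq
  · rintro rfl
    exact ⟨m, f m, d, hd, hm, (hf _ _).2 rfl, hq⟩

/-- Comparability in **3** is equality, so it suffices that X and X⁻ have different colours. The
argument depends on whether the label changes already at the second element of X. -/
theorem isBad_three (h : IsModelRCA0 M S) {L : Set M → Prop} {G : Set M → M → Prop}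
    (hG : ∀ X, X ∈ S → IsInf X → ∀ q, G X q ↔ ThreeGraph L X q) : IsBad S (three M) G := by
  rintro ⟨X, hX, hi, p, q, hp, hq, r, -, hr⟩
  obtain ⟨hpr, hqr⟩ := pair_inj.1 hr
  obtain rfl : p = q := hpr.trans hqr.symm
  obtain ⟨x₀, hx₀, hmin⟩ := h.exists_min hX hi
  obtain ⟨x₁, hx₁⟩ := h.exists_next hX hi x₀
  have hX' := h.above_mem hX x₁
  have hi' := hi.above x₁
  have htail : tail X = above X x₁ := by
    rw [← hx₁.tail_above hx₀, above_eq_self hmin]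
  rw [htail] at hq
  obtain ⟨m, j, d, hd, hm, hj, hp⟩ := (hG X hX hi p).1 hp
  obtain ⟨m', j', d', hd', hm', hj', hq⟩ := (hG _ hX' hi' p).1 hq
  obtain ⟨f, hf₀, hf₁, hf₂, hf, hfd⟩ := h.exists_count hX
  obtain ⟨f', hf₀', hf₁', hf₂', hf', hfd'⟩ := h.exists_count hX'
  rw [hf] at hj
  rw [hf'] at hj'
  have hmem : ∀ {y}, x₀ < y → (y ∈ above X x₁ ↔ y ∈ X) := fun hy =>
    mem_above.trans ⟨fun h' => h'.1, fun h' => ⟨h', hx₁.le h' hy⟩⟩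
  have hfx₀ : f x₀ = 0 := h.count_eq_zero hf₀ hf₂ hfd hmin
  have hfx₁' : f' x₁ = 0 := h.count_eq_zero hf₀' hf₂' hfd' fun z hz => (mem_above.1 hz).2
  have hfx₀' : f' (x₀ + 1) = 0 := h.count_eq_zero hf₀' hf₂' hfd' fun z hz =>
    (Order.add_one_le_iff.2 hx₁.1).trans (mem_above.1 hz).2
  -- Above its minimum, X has exactly one more element than X⁻ below any given number.
  have hff : ∀ y, x₀ < y → f y = f' y + 1 := by
    have i₁ := hfd.comp₂ (P := fun _ y j => j = f y) h
    have i₂ := hfd'.comp₂ (P := fun _ y j => j = f' y) h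
    have : ∀ y, x₀ < y → ∃ j, j < y + 1 ∧ j = f' y ∧ j + 1 = f y := by
      refine h.induction (P := fun y => x₀ < y → ∃ j, j < y + 1 ∧ j = f' y ∧ j + 1 = f y)
        (by infer_instance) (fun h0 => (_root_.not_lt_zero h0).elim) (fun y ih hy => ?_)
      refine ⟨f' (y + 1), Order.lt_add_one_iff.2 (hf₀' _), rfl, ?_⟩
      rcases eq_or_lt_of_le (Order.lt_add_one_iff.1 hy) with rfl | hlt
      · rw [hfx₀', hf₁ _ hx₀, hfx₀]
      · obtain ⟨j, -, hj₁, hj₂⟩ := ih hlt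
        by_cases hyX : y ∈ X
        · rw [hf₁ _ hyX, hf₁' _ ((hmem hlt).2 hyX), ← hj₁, hj₂]
        · rw [hf₂ _ hyX, hf₂' _ fun hy' => hyX ((hmem hlt).1 hy'), ← hj₁, hj₂]
    intro y hy
    obtain ⟨j, -, hj₁, hj₂⟩ := this y hy
    rw [← hj₂, hj₁]
  have hmx₀ : x₀ < m := lt_of_le_of_ne (hmin m hm.1) fun e =>
    hm.2.1 (by rw [← e, above_eq_self hmin])
  -- If the change occurs at the second element, the count is 1 and X is coloured by its label,
  -- which X⁻ does not share. Otherwise X⁻ has the same label and first change, and only the parity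
  -- differs.
  rcases eq_or_lt_of_le (hx₁.le hm.1 hmx₀) with rfl | hlt
  · rw [hff _ hmx₀, hfx₁', zero_add] at hj
    rw [hj] at hp
    have hpd := hp.of_one
    rcases hq with ⟨k, -, -, hq⟩ | ⟨k, -, -, hq⟩
    · exact hm.2.1 ((hd'.eq_iff hd).1 (hq.symm.trans hpd))
    · exact hd.ne_two (hpd.symm.trans hq)
  · have hLL : L (above X x₁) ↔ L X := hm.2.2 x₁ hx₁.2.1 hlt
    have hm₂ : FirstChange L (above X x₁) m := by
      refine ⟨(hmem hmx₀).2 hm.1, ?_, fun z hz hzm => ?_⟩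
      · rw [above_above hlt.le, hLL]; exact hm.2.1
      · obtain ⟨hz, hxz⟩ := mem_above.1 hz
        rw [above_above hxz, hLL]; exact hm.2.2 z hz hzm
    obtain rfl := hm'.unique hm₂
    rw [(hd'.eq_iff hd).2 hLL, hj'] at hq
    rw [hj, hff _ hmx₀] at hp
    exact hp.not_succ hd.ne_two hq

/-- A label of the infinite sets that changes along the final segments of any set, and for which
the first change is `Σ⁰₂`-definable, refutes that the discrete order with three elements is
`Δ⁰₂`-BQO. -/
theorem not_isDelta2BQO_three (h : IsModelRCA0 M S) {L : Set M → Prop}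
    {Q₀ Q₁ : Set M → M → M → M → Prop}
    (hQ₀ : Def0 S (fun X (w : Fin 3 → M) => Q₀ X (w 0) (w 1) (w 2)))
    (hQ₁ : Def0 S (fun X (w : Fin 3 → M) => Q₁ X (w 0) (w 1) (w 2)))
    (h₀ : ∀ X, X ∈ S → IsInf X → ∀ m, (∃ x, ∀ y, Q₀ X y x m) ↔ ¬ L X ∧ FirstChange L X m)
    (h₁ : ∀ X, X ∈ S → IsInf X → ∀ m, (∃ x, ∀ y, Q₁ X y x m) ↔ L X ∧ FirstChange L X m)
    (hL : ∀ X, X ∈ S → IsInf X → ∃ m, FirstChange L X m) : ¬ IsDelta2BQO S (three M) := by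
  intro h3
  obtain ⟨B, hB⟩ := h.nonempty
  have i₀ := hQ₀.comp₃ h
  have i₁ := hQ₁.comp₃ h
  have i₂ := (def0_countBelow (S := S)).comp₃ h
  -- A single number e codes the change m, its Σ⁰₂-witness x, the bound t on the counting code, the
  -- count j and the label d. Under the quantifier over y, injectivity of pairs keeps all these
  -- components fixed.
  let D : Set M → M → M → M → Prop := fun X y e q =>
    ∃ m, m < e + 1 ∧ ∃ x, x < e + 1 ∧ ∃ t, t < e + 1 ∧ ∃ j, j < e + 1 ∧ ∃ d, d < 1 + 1 ∧
      e = pair (pair m x) (pair t (pair j d)) ∧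
      ((d = 1 ∧ Q₁ X y x m) ∨ (d = 0 ∧ Q₀ X y x m)) ∧ CountBelow X m j t ∧ Colour d j q
  have hD : Def0 S (fun X (w : Fin 3 → M) => D X (w 0) (w 1) (w 2)) := by
    simp only [D]; unfold Colour; infer_instance
  obtain ⟨k, n, θ, P, v, hP, hθ⟩ := hD.exists_sigma2Graph hB
  have hG : ∀ X, X ∈ S → IsInf X → ∀ q, Sigma2Graph θ P v X q ↔ ThreeGraph L X q := by
    intro X hX hi q
    rw [hθ]
    constructor
    · rintro ⟨e, he⟩
      obtain ⟨m, -, x, -, t, -, j, -, d, -, he', hd, ht, hq⟩ := he 0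
      have hall : ∀ y, (d = 1 ∧ Q₁ X y x m) ∨ (d = 0 ∧ Q₀ X y x m) := by
        intro y
        obtain ⟨m', -, x', -, t', -, j', -, d', -, he'', hd', -⟩ := he y
        obtain ⟨h₁, h₂⟩ := pair_inj.1 (he'.symm.trans he'')
        obtain ⟨h₃, h₄⟩ := pair_inj.1 h₁
        obtain ⟨-, h₅⟩ := pair_inj.1 (pair_inj.1 h₂).2
        rwa [← h₃, ← h₄, ← h₅] at hd'
      rcases hd with ⟨rfl, -⟩ | ⟨rfl, -⟩
      · obtain ⟨hLX, hm⟩ := (h₁ X hX hi m).1 ⟨x, fun y => by simpa using hall y⟩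
        exact ⟨m, j, 1, .inl ⟨rfl, hLX⟩, hm, ⟨t, ht⟩, hq⟩
      · obtain ⟨hLX, hm⟩ := (h₀ X hX hi m).1 ⟨x, fun y => by simpa using hall y⟩
        exact ⟨m, j, 0, .inr ⟨rfl, hLX⟩, hm, ⟨t, ht⟩, hq⟩
    · rintro ⟨m, j, d, hd, hm, ⟨t, ht⟩, hq⟩
      have hx : ∃ x, d < 1 + 1 ∧ ∀ y, (d = 1 ∧ Q₁ X y x m) ∨ (d = 0 ∧ Q₀ X y x m) := by
        rcases hd with ⟨rfl, hd⟩ | ⟨rfl, hd⟩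
        · obtain ⟨x, hx⟩ := (h₁ X hX hi m).2 ⟨hd, hm⟩
          exact ⟨x, lt_add_one _, fun y => .inl ⟨rfl, hx y⟩⟩
        · obtain ⟨x, hx⟩ := (h₀ X hX hi m).2 ⟨hd, hm⟩
          exact ⟨x, add_pos one_pos one_pos, fun y => .inr ⟨rfl, hx y⟩⟩
      obtain ⟨x, hd2, hx⟩ := hx
      refine ⟨pair (pair m x) (pair t (pair j d)), fun y => ⟨m, ?_, x, ?_, t, ?_, j, ?_, d, hd2,
        rfl, hx y, ht, hq⟩⟩ <;> rw [Order.lt_add_one_iff]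
      · exact (le_pair_left _ _).trans (le_pair_left _ _)
      · exact (le_pair_right _ _).trans (le_pair_left _ _)
      · exact (le_pair_left _ _).trans (le_pair_right _ _)
      · exact ((le_pair_left _ _).trans (le_pair_right _ _)).trans (le_pair_right _ _)
  exact h3 k n θ P v hP (isFunctionTo_three h hG hL) (isBad_three h hG)

end

section

variable {M : Type u} [L2 M] {S : Set (Set M)} [IsArith M]

/-! ## Arithmetical comprehension -/

/-- In the enumeration of the `Σ⁰₁`-set `{n | ∃ x, Q x n}`, the element `n` enters at stage `s`. -/
def Enters (Q : M → M → Prop) (n s : M) : Prop :=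
  ∃ x, x < s + 1 ∧ s = pair x n ∧ Q x n ∧ ∀ x', x' < x → ¬ Q x' n

/-- At stage `t` some element enters, and no smaller element enters between the stages `t` and
`w`. -/
def TrueBelow (Q : M → M → Prop) (w t : M) : Prop :=
  ∃ n, n < t + 1 ∧ Enters Q n t ∧ ∀ s, s < w → t < s → ∀ n', n' < n → ¬ Enters Q n' s

/-- The interval from `z` to `z'` contains a stage that is true up to `w`. -/
def Hits (Q : M → M → Prop) (w z z' : M) : Prop := ∃ t, t < z' ∧ z ≤ t ∧ TrueBelow Q w t

/-- The interval between the first two elements of `X` contains a true stage. -/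
def TrueLabel (Q : M → M → Prop) (X : Set M) : Prop :=
  ∀ z z', z ∈ X → (∀ x, x ∈ X → z ≤ x) → Next X z z' → ∀ w, Hits Q w z z'

variable {Q : M → M → Prop}

theorem Enters.le {n s : M} (h : Enters Q n s) : n ≤ s := by
  obtain ⟨x, -, rfl, -⟩ := h
  exact le_pair_right _ _

theorem Enters.unique_stage {n s s' : M} (h : Enters Q n s) (h' : Enters Q n s') : s = s' := by
  obtain ⟨x, -, rfl, hx, hmin⟩ := h
  obtain ⟨x', -, rfl, hx', hmin'⟩ := h'
  rcases lt_trichotomy x x' with h | rfl | h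
  · exact (hmin' _ h hx).elim
  · rfl
  · exact (hmin _ h hx').elim

theorem Hits.anti {w w' z z' : M} (h : Hits Q w' z z') (hw : w ≤ w') : Hits Q w z z' := by
  obtain ⟨t, ht, hzt, n, hn, hnt, hs⟩ := h
  exact ⟨t, ht, hzt, n, hn, hnt, fun s hsw => hs s (hsw.trans_le hw)⟩

/-- Once the next element z' is known, the label of the final segment that starts at z is a
Π⁰₁-property. -/
theorem trueLabel_above {X : Set M} {z z' : M} (hz : z ∈ X) (hz' : Next X z z') :
    TrueLabel Q (above X z) ↔ ∀ w, Hits Q w z z' := by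
  have hn : Next (above X z) z z' :=
    ⟨hz'.1, mem_above.2 ⟨hz'.2.1, hz'.1.le⟩, fun t ht hzt hm => hz'.2.2 t ht hzt (mem_above.1 hm).1⟩
  constructor
  · exact fun h => h z z' (mem_above.2 ⟨hz, le_rfl⟩) (fun x hx => (mem_above.1 hx).2) hn
  · intro h y y' hy hmin hy'
    obtain rfl : z = y := le_antisymm (mem_above.1 hy).2 (hmin z (mem_above.2 ⟨hz, le_rfl⟩))
    rwa [← hn.unique hy']

theorem def0_enters (h : IsModelRCA0 M S)
    (hQ : Def0 S (fun _ (w : Fin 2 → M) => Q (w 0) (w 1))) :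
    ∀ ⦃n : ℕ⦄ (s t : (Fin n → M) → M) [IsTerm s] [IsTerm t],
      Def0 S (fun _ v => Enters Q (s v) (t v)) := by
  have := hQ.comp₂ (P := fun _ => Q) h
  refine Def0.comp₂ (P := fun _ => Enters Q) h ?_
  unfold Enters; infer_instance

theorem def0_hits (h : IsModelRCA0 M S)
    (hQ : Def0 S (fun _ (w : Fin 2 → M) => Q (w 0) (w 1))) :
    ∀ ⦃n : ℕ⦄ (r s t : (Fin n → M) → M) [IsTerm r] [IsTerm s] [IsTerm t],
      Def0 S (fun _ v => Hits Q (r v) (s v) (t v)) := by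
  have := def0_enters h hQ
  refine Def0.comp₃ (P := fun _ => Hits Q) h ?_
  unfold Hits TrueBelow; infer_instance

namespace IsModelRCA0

theorem exists_enters_iff (h : IsModelRCA0 M S)
    (hQ : Def0 S (fun _ (w : Fin 2 → M) => Q (w 0) (w 1))) (n : M) :
    (∃ s, Enters Q n s) ↔ ∃ x, Q x n := by
  constructor
  · rintro ⟨s, x, -, -, hx, -⟩
    exact ⟨x, hx⟩
  · rintro ⟨x, hx⟩
    obtain ⟨k, hk, hmin⟩ := h.least (P := fun x => Q x n) (hQ.subst ![.inl 0, .inr n]) hx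
    exact ⟨pair k n, k, Order.lt_add_one_iff.2 (le_pair_left _ _), rfl, hk, hmin⟩

theorem exists_last_le (h : IsModelRCA0 M S) {X : Set M} (hX : X ∈ S) {x s : M} (hx : x ∈ X)
    (hxs : x ≤ s) : ∃ z, z ∈ X ∧ z ≤ s ∧ ∀ t, t ∈ X → z < t → s < t := by
  have : Fact (X ∈ S) := ⟨hX⟩
  obtain ⟨z, hz, hzX, hzt⟩ := h.induction
    (P := fun y => x ≤ y → ∃ z, z < y + 1 ∧ z ∈ X ∧ ∀ t, t < y + 1 → z < t → t ∉ X)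
    (by infer_instance) (fun hx0 => ⟨0, Order.lt_add_one_iff.2 le_rfl,
      (hx0.antisymm zero_le) ▸ hx, fun t ht h0 =>
        ((Order.lt_add_one_iff.1 ht).not_gt h0).elim⟩) (fun y ih hy => by
    by_cases hyX : y + 1 ∈ X
    · exact ⟨y + 1, Order.lt_add_one_iff.2 le_rfl, hyX, fun t ht h0 =>
        ((Order.lt_add_one_iff.1 ht).not_gt h0).elim⟩
    · rcases eq_or_lt_of_le hy with rfl | hlt
      · exact (hyX hx).elim
      · obtain ⟨z, hz, hzX, hzt⟩ := ih (Order.lt_add_one_iff.1 hlt)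
        refine ⟨z, hz.trans (Order.lt_add_one_iff.2 le_rfl), hzX, fun t ht h0 => ?_⟩
        rcases eq_or_lt_of_le (Order.lt_add_one_iff.1 ht) with rfl | hlt
        · exact hyX
        · exact hzt t hlt h0) s hxs
  refine ⟨z, hzX, Order.lt_add_one_iff.1 hz, fun t htX hzt' => not_le.1 fun hts => ?_⟩
  exact hzt t (Order.lt_add_one_iff.2 hts) hzt' htX

/-- If each interval between consecutive elements of `X` contains a true stage, then the model
contains the enumerated set. -/
theorem mem_of_forall_trueLabel (h : IsModelRCA0 M S)
    (hQ : Def0 S (fun _ (w : Fin 2 → M) => Q (w 0) (w 1))) {X : Set M} (hX : X ∈ S)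
    (hi : IsInf X) (hL : ∀ z, z ∈ X → TrueLabel Q (above X z)) : {n | ∃ x, Q x n} ∈ S := by
  have : Fact (X ∈ S) := ⟨hX⟩
  have i₁ := def0_enters h hQ
  have hE : Def0 S (fun _ (w : Fin 2 → M) => Enters Q (w 0) (w 1)) := i₁ _ _
  simp only [← h.exists_enters_iff hQ]
  have i₂ : Def0 S (fun _ (w : Fin 2 → M) => Next X (w 0) (w 1)) := by
    unfold Next; infer_instance
  have i₃ := i₂.comp₂ (P := fun _ => Next X) h
  -- The Π⁰₁-description of membership: no interval [x, x') of X is such that n has not entered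
  -- before x' and nothing up to n enters inside.
  refine h.comprehension (Q := fun s n => Enters Q n s) (R := fun e n =>
    ¬ ∃ x, x < e ∧ ∃ x', x' < e ∧ x ∈ X ∧ Next X x x' ∧ (∀ s, s < x' → ¬ Enters Q n s) ∧
      ∀ t, t < x' → x ≤ t → ∀ n', n' < n + 1 → ¬ Enters Q n' t)
    (by infer_instance) (by infer_instance) fun n => ⟨?_, fun hn => ?_⟩
  · rintro ⟨s, hs⟩ e ⟨x, -, x', -, hx, hxx', h₁, h₂⟩
    have hs' : x' ≤ s := not_lt.1 fun hlt => h₁ s hlt hs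
    obtain ⟨t, ht, hxt, n', -, hn't, htrue⟩ := (trueLabel_above hx hxx').1 (hL x hx) (s + 1)
    refine h₂ t ht hxt n' (Order.lt_add_one_iff.2 (not_lt.1 fun hnn' => ?_)) hn't
    exact htrue s (Order.lt_add_one_iff.2 le_rfl) (ht.trans_le hs') n hnn' hs
  · by_contra hcon
    -- Strong collection bounds the stages at which numbers up to n enter. Any later interval then
    -- shows that n never enters.
    obtain ⟨u, hu⟩ := h.strong_collection (Q := fun s n => Enters Q n s) (by infer_instance) (n + 1)
    obtain ⟨x, hx, hux⟩ := hi u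
    obtain ⟨x', hxx'⟩ := h.exists_next hX hi x
    refine hn (x + x' + 1) ⟨x, Order.lt_add_one_iff.2 le_self_add, x',
      Order.lt_add_one_iff.2 le_add_self, hx, hxx', fun s _ hs => hcon ⟨s, hs⟩,
      fun t _ hxt n' hn' hn't => ?_⟩
    obtain ⟨s, hsu, hs⟩ := hu n' hn' ⟨t, hn't⟩
    rw [hs.unique_stage hn't] at hsu
    exact (hsu.trans hux).not_ge hxt

/-- If no interval between consecutive elements of `X` contains a true stage, then the model
contains the enumerated set. -/
theorem mem_of_forall_not_trueLabel (h : IsModelRCA0 M S)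
    (hQ : Def0 S (fun _ (w : Fin 2 → M) => Q (w 0) (w 1))) {X : Set M} (hX : X ∈ S)
    (hi : IsInf X) (hL : ∀ z, z ∈ X → ¬ TrueLabel Q (above X z)) : {n | ∃ x, Q x n} ∈ S := by
  have i₁ := def0_enters h hQ
  obtain ⟨x, hx, -⟩ := hi 0
  by_cases hb : ∃ n s, x ≤ s ∧ Enters Q n s
  · obtain ⟨n, s, hs⟩ := hb
    -- The smallest number that enters at or after stage x does so at a true stage, and some
    -- interval of X contains this stage.
    obtain ⟨n, ⟨s, hxs, hns⟩, hmin⟩ := h.least_sigma (Q := fun s n => x ≤ s ∧ Enters Q n s)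
      (by infer_instance) ⟨s, hs⟩
    obtain ⟨z, hz, hzs, hzt⟩ := h.exists_last_le hX hx hxs
    obtain ⟨z', hzz'⟩ := h.exists_next hX hi z
    refine (hL z hz ((trueLabel_above hz hzz').2 fun w => ?_)).elim
    exact ⟨s, hzt z' hzz'.2.1 hzz'.1, hzs, n, Order.lt_add_one_iff.2 hns.le, hns,
      fun s' _ hss' n' hn' he => hmin n' hn' s' ⟨hxs.trans hss'.le, he⟩⟩
  · push Not at hb
    have : {n | ∃ s, s < x ∧ Enters Q n s} ∈ S :=
      h.def0_mem (P := fun n => ∃ s, s < x ∧ Enters Q n s) (by infer_instance)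
    convert this using 3 with n
    rw [← h.exists_enters_iff hQ]
    exact ⟨fun ⟨s, hs⟩ => ⟨s, not_le.1 fun hxs => hb n s hxs hs, hs⟩, fun ⟨s, _, hs⟩ => ⟨s, hs⟩⟩

/-- A constant label would put the enumerated set into the model, so a change occurs. Along final
segments of X the negative label is Σ⁰₁ and the positive one Π⁰₁, and the corresponding least number
principle finds the first change. -/
theorem exists_firstChange_trueLabel (h : IsModelRCA0 M S)
    (hQ : Def0 S (fun _ (w : Fin 2 → M) => Q (w 0) (w 1))) (hK : {n | ∃ x, Q x n} ∉ S)
    {X : Set M} (hX : X ∈ S) (hi : IsInf X) : ∃ m, FirstChange (TrueLabel Q) X m := by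
  have : Fact (X ∈ S) := ⟨hX⟩
  have i₁ := def0_hits h hQ
  have i₂ : Def0 S (fun _ (w : Fin 2 → M) => Next X (w 0) (w 1)) := by
    unfold Next; infer_instance
  have i₃ := i₂.comp₂ (P := fun _ => Next X) h
  choose nx hnx using h.exists_next hX hi
  by_cases hLX : TrueLabel Q X
  · have hex : ∃ z, z ∈ X ∧ ¬ TrueLabel Q (above X z) := by
      by_contra! hcon
      exact hK (h.mem_of_forall_trueLabel hQ hX hi hcon)
    have key : ∀ z, (z ∈ X ∧ ¬ TrueLabel Q (above X z)) ↔ ∃ e, z ∈ X ∧ ∃ z', z' < e ∧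
        Next X z z' ∧ ∃ w, w < e ∧ ¬ Hits Q w z z' := by
      intro z
      constructor
      · rintro ⟨hz, hzL⟩
        rw [trueLabel_above hz (hnx z)] at hzL
        push Not at hzL
        obtain ⟨w, hw⟩ := hzL
        exact ⟨nx z + w + 1, hz, nx z, Order.lt_add_one_iff.2 le_self_add, hnx z, w,
          Order.lt_add_one_iff.2 le_add_self, hw⟩
      · rintro ⟨e, hz, z', -, hzz', w, -, hw⟩
        rw [trueLabel_above hz hzz']
        exact ⟨hz, fun hall => hw (hall w)⟩
    obtain ⟨z, hz⟩ := hex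
    obtain ⟨m, hm, hmin⟩ := h.least_sigma (Q := fun e z => z ∈ X ∧ ∃ z', z' < e ∧
        Next X z z' ∧ ∃ w, w < e ∧ ¬ Hits Q w z z') (by infer_instance) ((key z).1 hz)
    obtain ⟨hmX, hmL⟩ := (key m).2 hm
    refine ⟨m, hmX, fun he => hmL (he.2 hLX), fun z hz hzm => ?_⟩
    refine iff_of_true (by_contra fun hzL => ?_) hLX
    obtain ⟨e, he⟩ := (key z).1 ⟨hz, hzL⟩
    exact hmin z hzm e he
  · have hex : ∃ z, z ∈ X ∧ TrueLabel Q (above X z) := by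
      by_contra! hcon
      exact hK (h.mem_of_forall_not_trueLabel hQ hX hi hcon)
    have key : ∀ z, (z ∈ X ∧ TrueLabel Q (above X z)) ↔ ∀ e, z ∈ X ∧ ∀ z', z' < e →
        Next X z z' → ∀ w, w < e → Hits Q w z z' := by
      intro z
      constructor
      · rintro ⟨hz, hzL⟩ e
        exact ⟨hz, fun z' _ hzz' w _ => (trueLabel_above hz hzz').1 hzL w⟩
      · intro hall
        have hz := (hall 0).1
        refine ⟨hz, (trueLabel_above hz (hnx z)).2 fun w => ?_⟩
        exact (hall (nx z + w + 1)).2 (nx z) (Order.lt_add_one_iff.2 le_self_add) (hnx z) w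
          (Order.lt_add_one_iff.2 le_add_self)
    obtain ⟨z, hz⟩ := hex
    obtain ⟨m, hm, hmin⟩ := h.least_pi (Q := fun e z => z ∈ X ∧ ∀ z', z' < e →
        Next X z z' → ∀ w, w < e → Hits Q w z z') (by infer_instance) ((key z).1 hz)
    obtain ⟨hmX, hmL⟩ := (key m).2 hm
    refine ⟨m, hmX, fun he => hLX (he.1 hmL), fun z hz hzm => ?_⟩
    refine iff_of_false (fun hzL => ?_) hLX
    obtain ⟨e, he⟩ := hmin z hzm
    exact he ((key z).1 ⟨hz, hzL⟩ e)

/-- `Σ⁰₁`-comprehension follows when the discrete order with three elements is `Δ⁰₂`-BQO. -/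
theorem sigma1_comprehension (h : IsModelRCA0 M S) (h3 : IsDelta2BQO S (three M))
    (hQ : Def0 S (fun _ (w : Fin 2 → M) => Q (w 0) (w 1))) : {n | ∃ x, Q x n} ∈ S := by
  by_contra hK
  have i₁ := def0_hits h hQ
  -- For a change from negative to positive, a single w refutes all intervals below m, and the
  -- interval at m passes every test y. In the other direction, the intervals below m pass all tests
  -- and some w refutes the one at m. The element z below m ensures that m is not the minimum.
  refine not_isDelta2BQO_three h (L := TrueLabel Q)
    (Q₀ := fun X y x m => m ∈ X ∧ (∃ z, z < m ∧ z ∈ X) ∧ (∃ w, w < x ∧ ∀ z, z < m →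
      ∀ z', z' < m + 1 → z ∈ X → Next X z z' → ¬ Hits Q w z z') ∧
      ∃ m', m' < x ∧ Next X m m' ∧ Hits Q y m m')
    (Q₁ := fun X y x m => m ∈ X ∧ (∃ z, z < m ∧ z ∈ X) ∧ (∀ z, z < m →
      ∀ z', z' < m + 1 → z ∈ X → Next X z z' → Hits Q y z z') ∧
      ∃ m', m' < x ∧ Next X m m' ∧ ∃ w, w < x ∧ ¬ Hits Q w m m')
    (by infer_instance) (by infer_instance) ?_ ?_
    (fun X hX hi => h.exists_firstChange_trueLabel hQ hK hX hi) h3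
  all_goals
    intro X hX hi m
    have : Fact (X ∈ S) := ⟨hX⟩
    have i₂ : Def0 S (fun _ (w : Fin 2 → M) => Next X (w 0) (w 1)) := by
      unfold Next; infer_instance
    have i₃ := i₂.comp₂ (P := fun _ => Next X) h
    choose nx hnx using h.exists_next hX hi
    obtain ⟨x₀, hx₀, hmin⟩ := h.exists_min hX hi
    have hX₀ : above X x₀ = X := above_eq_self hmin
    have hlt : ∀ m, FirstChange (TrueLabel Q) X m → x₀ < m := fun m hm =>
      lt_of_le_of_ne (hmin m hm.1) fun e => hm.2.1 (by rw [← e, hX₀])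
  · constructor
    · rintro ⟨x, hx⟩
      obtain ⟨hm, ⟨z₀, hz₀m, hz₀⟩, ⟨w, -, hw⟩, m', -, hmm', -⟩ := hx 0
      have hL : ∀ z, z ∈ X → z < m → ¬ TrueLabel Q (above X z) := by
        intro z hz hzm hzL
        refine hw z hzm (nx z) (Order.lt_add_one_iff.2 ((hnx z).le hm hzm)) hz (hnx z) ?_
        exact (trueLabel_above hz (hnx z)).1 hzL w
      have hLX : ¬ TrueLabel Q X := hX₀ ▸ hL x₀ hx₀ ((hmin _ hz₀).trans_lt hz₀m)
      refine ⟨hLX, hm, fun he => hLX (he.1 ?_), fun z hz hzm => iff_of_false (hL z hz hzm) hLX⟩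
      refine (trueLabel_above hm hmm').2 fun y => ?_
      obtain ⟨-, -, -, m'', -, hmm'', hy⟩ := hx y
      rwa [hmm'.unique hmm'']
    · rintro ⟨hLX, hm⟩
      -- Refutations persist when w increases (`Hits.anti`), so the bound from collection refutes
      -- all intervals below m at once.
      obtain ⟨u, hu⟩ := h.collection (Q := fun w z => z ∈ X → ∀ z', z' < m + 1 →
        Next X z z' → ¬ Hits Q w z z') (by infer_instance) (n := m) (fun z hzm => by
          by_cases hz : z ∈ X
          · have := mt (hm.2.2 z hz hzm).1 hLX
            rw [trueLabel_above hz (hnx z)] at this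
            push Not at this
            obtain ⟨w, hw⟩ := this
            exact ⟨w, fun _ z' _ hzz' => (hnx z).unique hzz' ▸ hw⟩
          · exact ⟨0, fun hz' => (hz hz').elim⟩)
      have hmL : TrueLabel Q (above X m) := by
        have := hm.2.1
        tauto
      rw [trueLabel_above hm.1 (hnx m)] at hmL
      refine ⟨nx m + u + 1, fun y => ⟨hm.1, ⟨x₀, hlt m hm, hx₀⟩, ⟨u,
        Order.lt_add_one_iff.2 le_add_self, fun z hzm z' hz' hz hzz' hhit => ?_⟩, nx m,
        Order.lt_add_one_iff.2 le_self_add, hnx m, hmL y⟩⟩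
      obtain ⟨w, hwu, hw⟩ := hu z hzm
      exact hw hz z' hz' hzz' (hhit.anti hwu.le)
  · constructor
    · rintro ⟨x, hx⟩
      obtain ⟨hm, ⟨z₀, hz₀m, hz₀⟩, -, m', -, hmm', w, -, hw⟩ := hx 0
      have hL : ∀ z, z ∈ X → z < m → TrueLabel Q (above X z) := by
        intro z hz hzm
        refine (trueLabel_above hz (hnx z)).2 fun y => ?_
        exact (hx y).2.2.1 z hzm (nx z) (Order.lt_add_one_iff.2 ((hnx z).le hm hzm)) hz (hnx z)
      have hLX : TrueLabel Q X := hX₀ ▸ hL x₀ hx₀ ((hmin _ hz₀).trans_lt hz₀m)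
      refine ⟨hLX, hm, fun he => hw ?_, fun z hz hzm => iff_of_true (hL z hz hzm) hLX⟩
      exact (trueLabel_above hm hmm').1 (he.2 hLX) w
    · rintro ⟨hLX, hm⟩
      have hmL : ¬ TrueLabel Q (above X m) := by
        have := hm.2.1
        tauto
      rw [trueLabel_above hm.1 (hnx m)] at hmL
      push Not at hmL
      obtain ⟨w, hw⟩ := hmL
      refine ⟨nx m + w + 1, fun y => ⟨hm.1, ⟨x₀, hlt m hm, hx₀⟩, fun z hzm z' hz' hz hzz' => ?_,
        nx m, Order.lt_add_one_iff.2 le_self_add, hnx m, w, Order.lt_add_one_iff.2 le_add_self,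
        hw⟩⟩
      exact (trueLabel_above hz hzz').1 ((hm.2.2 z hz hzm).2 hLX) y

end IsModelRCA0

end

section

variable {M : Type u} [L2 M] {S : Set (Set M)} [IsArith M]

/-! ## Enumeration of infinite sets -/

/-- Any infinite set of the model has an increasing enumeration; it is given by the inverse of the
function `f` on `X`. -/
theorem IsModelRCA0.exists_enumeration (h : IsModelRCA0 M S) {X : Set M} (hX : X ∈ S)
    (hi : IsInf X) : ∃ f : M → M, Def0 S (fun _ (w : Fin 2 → M) => w 1 = f (w 0)) ∧
      (∀ n, ∃ z, z ∈ X ∧ f z = n) ∧ (∀ z z', z ∈ X → z' ∈ X → f z = f z' → z = z') ∧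
      ∀ z z', z ∈ X → z' ∈ X → f z' = f z + 1 → Next X z z' := by
  have : Fact (X ∈ S) := ⟨hX⟩
  obtain ⟨f, hf₀, hf₁, hf₂, -, hfd⟩ := h.exists_count hX
  have i₁ := hfd.comp₂ (P := fun _ y j => j = f y) h
  choose nx hnx using h.exists_next hX hi
  have mono : ∀ y y', y ≤ y' → f y ≤ f y' := by
    intro y y' hy
    obtain ⟨j, -, rfl, hj⟩ := h.induction
      (P := fun y' => y ≤ y' → ∃ j, j < y' + 1 ∧ j = f y' ∧ f y ≤ j) (by infer_instance)
      (fun h0 => ⟨f 0, Order.lt_add_one_iff.2 (hf₀ 0), rfl, by rw [h0.antisymm zero_le]⟩)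
      (fun m ih hm => ⟨f (m + 1), Order.lt_add_one_iff.2 (hf₀ _), rfl, by
        rcases eq_or_lt_of_le hm with rfl | hlt
        · exact le_rfl
        · obtain ⟨j, -, rfl, hj⟩ := ih (Order.lt_add_one_iff.1 hlt)
          by_cases hmX : m ∈ X
          · rw [hf₁ m hmX]; exact hj.trans le_self_add
          · rw [hf₂ m hmX]; exact hj⟩) y' hy
    exact hj
  -- The count rises by one directly above z and then stays constant, since no element of X lies
  -- strictly between z and its successor.
  have hstep : ∀ z, z ∈ X → f (nx z) = f z + 1 := by
    intro z hz
    refine (h.induction (P := fun y => z < y → y ≤ nx z → f z + 1 = f y) (by infer_instance)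
      (fun h0 => (_root_.not_lt_zero h0).elim) (fun y ih hy hyn => ?_) (nx z) (hnx z).1
      le_rfl).symm
    rcases eq_or_lt_of_le (Order.lt_add_one_iff.1 hy) with rfl | hlt
    · rw [hf₁ _ hz]
    · have hyn' := Order.add_one_le_iff.1 hyn
      rw [hf₂ y ((hnx z).2.2 y hyn' hlt)]
      exact ih hlt hyn'.le
  have hlt : ∀ z z', z ∈ X → z' ∈ X → z < z' → f z < f z' := by
    intro z z' hz hz' hzz'
    have := mono _ _ ((hnx z).le hz' hzz')
    rw [hstep z hz] at this
    exact Order.add_one_le_iff.1 this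
  have inj : ∀ z z', z ∈ X → z' ∈ X → f z = f z' → z = z' := by
    intro z z' hz hz' he
    rcases lt_trichotomy z z' with h' | h' | h'
    · exact ((hlt z z' hz hz' h').ne he).elim
    · exact h'
    · exact ((hlt z' z hz' hz h').ne he.symm).elim
  refine ⟨f, hfd, fun n => ?_, inj, fun z z' hz hz' he => ?_⟩
  · have := h.induction_ex (Q := fun z n => z ∈ X ∧ n = f z) (by infer_instance) (by
      obtain ⟨x₀, hx₀, hmin⟩ := h.exists_min hX hi
      exact ⟨x₀, hx₀, (h.count_eq_zero hf₀ hf₂ hfd hmin).symm⟩)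
      (fun m ⟨z, hz, hm⟩ => ⟨nx z, (hnx z).2.1, by rw [hstep z hz, hm]⟩) n
    obtain ⟨z, hz, hn⟩ := this
    exact ⟨z, hz, hn.symm⟩
  · have : nx z = z' := inj _ _ (hnx z).2.1 hz' ((hstep z hz).trans he.symm)
    exact this ▸ hnx z

/-! ## Consequences of arithmetical comprehension -/

/-- The model satisfies `Σ⁰₁`-comprehension, and hence arithmetical comprehension. -/
def IsACA (S : Set (Set M)) : Prop :=
  ∀ Q : M → M → Prop, Def0 S (fun _ (w : Fin 2 → M) => Q (w 0) (w 1)) → {n | ∃ x, Q x n} ∈ S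

/-- The relation is coded as a set of pairs in the model, which can then serve as a parameter. So an
unbounded quantifier is absorbed into a bounded formula, and this can be iterated. -/
theorem IsACA.def0_exists (hA : IsACA S) {Q : M → M → M → Prop}
    (hQ : ∀ ⦃n : ℕ⦄ (r s t : (Fin n → M) → M) [IsTerm r] [IsTerm s] [IsTerm t],
      Def0 S (fun _ v => Q (r v) (s v) (t v))) :
    Def0 S (fun _ (w : Fin 2 → M) => ∃ x, Q x (w 0) (w 1)) := by
  have : Fact (_ ∈ S) := ⟨hA (fun x m => ∃ a, a < m + 1 ∧ ∃ b, b < m + 1 ∧ m = pair a b ∧ Q x a b)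
    (by infer_instance)⟩
  refine (inferInstance : Def0 S (fun _ (w : Fin 2 → M) => pair (w 0) (w 1) ∈
    {m | ∃ x, ∃ a, a < m + 1 ∧ ∃ b, b < m + 1 ∧ m = pair a b ∧ Q x a b})).congr fun _ w => ?_
  constructor
  · rintro ⟨x, a, -, b, -, he, hx⟩
    obtain ⟨h₁, h₂⟩ := pair_inj.1 he
    exact ⟨x, h₁ ▸ h₂ ▸ hx⟩
  · rintro ⟨x, hx⟩
    exact ⟨x, _, Order.lt_add_one_iff.2 (le_pair_left _ _), _,
      Order.lt_add_one_iff.2 (le_pair_right _ _), rfl, hx⟩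

theorem Def0.above {E : Set M → M → M → Prop} (h : IsModelRCA0 M S)
    (hE : Def0 S (fun X (w : Fin 2 → M) => E X (w 0) (w 1))) :
    ∀ ⦃n : ℕ⦄ (r s t : (Fin n → M) → M) [IsTerm r] [IsTerm s] [IsTerm t],
      Def0 S (fun X v => E (above X (r v)) (s v) (t v)) := by
  have h₁ : Def0 S (fun X (w : Fin 3 → M) => E X (w 1) (w 2)) := hE.subst ![.inl 1, .inl 2]
  exact Def0.comp₃ (P := fun X r s t => E (RevMath.above X r) s t) h (h₁.restrict 0)

/-- A `Σ⁰₂`-definition of the first change of a label from positive to negative, where the label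
and its complement are defined by `∃ x, ∀ y, E` and `∃ x, ∀ y, E'`. -/
def ChangeMatrix (E E' : Set M → M → M → Prop) (X : Set M) (w u m : M) : Prop :=
  m ∈ X ∧ (∃ z, z < m ∧ z ∈ X) ∧
    (∀ z, z < m → z ∈ X → ∃ x, x < u ∧ ∀ y, y < w → E (above X z) y x) ∧
    ∃ x, x < u ∧ ∀ y, y < w → E' (above X m) y x

theorem def0_changeMatrix (h : IsModelRCA0 M S) {E E' : Set M → M → M → Prop}
    (hE : Def0 S (fun X (w : Fin 2 → M) => E X (w 0) (w 1)))
    (hE' : Def0 S (fun X (w : Fin 2 → M) => E' X (w 0) (w 1))) :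
    Def0 S (fun X (w : Fin 3 → M) => ChangeMatrix E E' X (w 0) (w 1) (w 2)) := by
  have := hE.above h
  have := hE'.above h
  unfold ChangeMatrix; infer_instance

theorem changeMatrix_iff (h : IsModelRCA0 M S) (hA : IsACA S) {L : Set M → Prop}
    {E E' : Set M → M → M → Prop}
    (hE : Def0 S (fun X (w : Fin 2 → M) => E X (w 0) (w 1)))
    (hE' : Def0 S (fun X (w : Fin 2 → M) => E' X (w 0) (w 1))) {X : Set M} (hX : X ∈ S)
    (hi : IsInf X) (hL : ∀ z, L (above X z) ↔ ∃ x, ∀ y, E (above X z) y x)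
    (hL' : ∀ z, ¬ L (above X z) ↔ ∃ x, ∀ y, E' (above X z) y x) (m : M) :
    (∃ u, ∀ w, ChangeMatrix E E' X w u m) ↔ L X ∧ FirstChange L X m := by
  have : Fact (X ∈ S) := ⟨hX⟩
  obtain ⟨x₀, hx₀, hmin⟩ := h.exists_min hX hi
  have hX₀ : above X x₀ = X := above_eq_self hmin
  -- If every x < u failed at some y, then collection would bound these y by some w, against the
  -- premise for that w. So the universal quantifier over w moves inside the bounded quantifier over
  -- x.
  have unbd : ∀ {E : Set M → M → M → Prop},
      Def0 S (fun X (w : Fin 2 → M) => E X (w 0) (w 1)) → ∀ {z u},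
      (∀ w, ∃ x, x < u ∧ ∀ y, y < w → E (above X z) y x) → ∃ x, ∀ y, E (above X z) y x := by
    intro E hE z u hw
    have i := (hE.inst (h.above_mem hX z)).comp₂ (P := fun _ => E (above X z)) h
    by_contra! hcon
    obtain ⟨w, hw'⟩ := h.collection (Q := fun y x => ¬ E (above X z) y x) (by infer_instance)
      (n := u) (fun x _ => hcon x)
    obtain ⟨x, hxu, hx⟩ := hw w
    obtain ⟨y, hyw, hy⟩ := hw' x hxu
    exact hy (hx y hyw)
  constructor
  · rintro ⟨u, hu⟩
    obtain ⟨hm, ⟨z₀, hz₀m, hz₀⟩, -⟩ := hu 0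
    have hpos : ∀ z, z ∈ X → z < m → L (above X z) := fun z hz hzm =>
      (hL z).2 (unbd hE fun w => (hu w).2.2.1 z hzm hz)
    have hneg : ¬ L (above X m) := (hL' m).2 (unbd hE' fun w => (hu w).2.2.2)
    have hLX : L X := hX₀ ▸ hpos x₀ hx₀ ((hmin _ hz₀).trans_lt hz₀m)
    exact ⟨hLX, hm, fun he => hneg (he.2 hLX), fun z hz hzm => iff_of_true (hpos z hz hzm) hLX⟩
  · rintro ⟨hLX, hm⟩
    have hneg : ¬ L (above X m) := fun hL => hm.2.1 (iff_of_true hL hLX)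
    obtain ⟨x', hx'⟩ := (hL' m).1 hneg
    have i₁ : ∀ ⦃n : ℕ⦄ (r s t : (Fin n → M) → M) [IsTerm r] [IsTerm s] [IsTerm t],
        Def0 S (fun _ v => E (above X (r v)) (s v) (t v)) :=
      fun n r s t _ _ _ => (hE.above h r s t).inst hX
    -- Comprehension turns the Π⁰₁-matrix into a bounded one. Collection then bounds the
    -- Σ⁰₂-witnesses for all z < m simultaneously.
    have i₂ := (hA.def0_exists (Q := fun y x z => ¬ E (above X z) y x)
      (fun n r s t _ _ _ => by infer_instance)).comp₂ (P := fun _ x z => ∃ y, ¬ E (above X z) y x) h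
    obtain ⟨u, hu⟩ := h.collection (Q := fun x z => z ∈ X → ¬ ∃ y, ¬ E (above X z) y x)
      (by infer_instance) (n := m) (fun z hzm => by
        by_cases hz : z ∈ X
        · obtain ⟨x, hx⟩ := (hL z).1 ((hm.2.2 z hz hzm).2 hLX)
          exact ⟨x, fun _ ⟨y, hy⟩ => hy (hx y)⟩
        · exact ⟨0, fun hz' => (hz hz').elim⟩)
    refine ⟨u + x' + 1, fun w => ⟨hm.1, ⟨x₀, lt_of_le_of_ne (hmin m hm.1) fun e =>
      hm.2.1 (by rw [← e, hX₀]), hx₀⟩, fun z hzm hz => ?_, x',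
      Order.lt_add_one_iff.2 le_add_self, fun y _ => hx' y⟩⟩
    obtain ⟨x, hxu, hx⟩ := hu z hzm
    refine ⟨x, Order.lt_add_one_iff.2 (hxu.le.trans le_self_add), fun y _ => ?_⟩
    by_contra hy
    exact hx hz ⟨y, hy⟩

/-! ## Functions into a sum -/

/-- The value of the function with graph `F` at `X` belongs to the summand with index `i`. -/
def Summand (F : Set M → M → Prop) (i : M) (X : Set M) : Prop := ∃ q, F X (pair i q)

variable {F : Set M → M → Prop} {Ω : CodedOrder M}

/-- This makes the label Δ⁰₂: its negation has a Σ⁰₂-definition as well. -/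
theorem not_summand_one_iff (hF : IsFunctionTo S (oplus Ω Ω) F) {X : Set M} (hX : X ∈ S)
    (hi : IsInf X) : ¬ Summand F 1 X ↔ Summand F 0 X := by
  obtain ⟨q, hq, hFq⟩ := hF X hX hi
  constructor
  · intro hn
    rcases hq with ⟨p, -, rfl⟩ | ⟨p, -, rfl⟩
    · exact ⟨p, (hFq _).2 rfl⟩
    · exact (hn ⟨p, (hFq _).2 rfl⟩).elim
  · rintro ⟨p, hp⟩ ⟨p', hp'⟩
    have := (pair_inj.1 (((hFq _).1 hp).trans ((hFq _).1 hp').symm)).1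
    exact zero_ne_one this

theorem Summand.exists_value (hF : IsFunctionTo S (oplus Ω Ω) F) {X : Set M} (hX : X ∈ S)
    (hi : IsInf X) {i : M} (h : Summand F i X) :
    ∃ p ∈ Ω.carrier, ∀ p', F X (pair i p') ↔ p' = p := by
  obtain ⟨q, hq, hFq⟩ := hF X hX hi
  obtain ⟨p, hp⟩ := h
  have hpq := (hFq _).1 hp
  refine ⟨p, ?_, fun p' => ?_⟩
  · rcases hq with ⟨r, hr, rfl⟩ | ⟨r, hr, rfl⟩ <;> exact (pair_inj.1 hpq).2 ▸ hr
  · rw [hFq, ← hpq, pair_inj]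
    exact and_iff_right rfl

/-- Along the final segments of an infinite set, a bad function cannot always have values in the
same copy of a well order. -/
theorem exists_not_summand (h : IsModelRCA0 M S) (hA : IsACA S) (hΩ : IsWellOrder S Ω)
    (hF : IsFunctionTo S (oplus Ω Ω) F) (hbad : IsBad S (oplus Ω Ω) F) {X : Set M} (hX : X ∈ S)
    (hi : IsInf X)
    (hR : Def0 S (fun _ (w : Fin 2 → M) => F (above X (w 0)) (w 1))) {i : M}
    (hi01 : i = 0 ∨ i = 1) : ∃ z, z ∈ X ∧ ¬ Summand F i (above X z) := by
  by_contra! hall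
  have : Fact (X ∈ S) := ⟨hX⟩
  obtain ⟨f, hfd, hsurj, hinj, hnext⟩ := h.exists_enumeration hX hi
  have i₁ := hfd.comp₂ (P := fun _ y j => j = f y) h
  have i₂ := hR.comp₂ (P := fun _ z q => F (above X z) q) h
  -- The n-th term is the Ω-component of the value of F at the final segment that starts with the
  -- n-th element of X.
  let G : Set M := {p | ∃ z, ∃ n, n < p + 1 ∧ ∃ q, q < p + 1 ∧ p = pair n q ∧ z ∈ X ∧ n = f z ∧
    F (above X z) (pair i q)}
  have hG : G ∈ S := hA (fun z p => ∃ n, n < p + 1 ∧ ∃ q, q < p + 1 ∧ p = pair n q ∧ z ∈ X ∧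
    n = f z ∧ F (above X z) (pair i q)) (by infer_instance)
  have hGiff : ∀ n q, pair n q ∈ G ↔ ∃ z, z ∈ X ∧ f z = n ∧ F (above X z) (pair i q) := by
    intro n q
    constructor
    · rintro ⟨z, n', -, q', -, he, hz, hn', hFz⟩
      obtain ⟨rfl, rfl⟩ := pair_inj.1 he
      exact ⟨z, hz, hn'.symm, hFz⟩
    · rintro ⟨z, hz, hn, hFz⟩
      exact ⟨z, n, Order.lt_add_one_iff.2 (le_pair_left _ _), q,
        Order.lt_add_one_iff.2 (le_pair_right _ _), rfl, hz, hn.symm, hFz⟩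
  have hval : ∀ z, z ∈ X → ∃ p ∈ Ω.carrier, ∀ p', F (above X z) (pair i p') ↔ p' = p :=
    fun z hz => (hall z hz).exists_value hF (h.above_mem hX z) (hi.above z)
  refine hΩ.no_descent ⟨G, hG, fun n => ?_, fun n p q hp hq => ?_⟩
  · obtain ⟨z, hz, rfl⟩ := hsurj n
    obtain ⟨p, hpΩ, hp⟩ := hval z hz
    refine ⟨p, hpΩ, fun p' => ?_⟩
    rw [hGiff, ← hp]
    constructor
    · rintro ⟨z', hz', he, hFz⟩
      rwa [← hinj z' z hz' hz he]
    · exact fun hFz => ⟨z, hz, rfl, hFz⟩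
  · obtain ⟨z, hz, rfl, hFz⟩ := (hGiff _ _).1 hp
    obtain ⟨z', hz', he, hFz'⟩ := (hGiff _ _).1 hq
    have hzz' := hnext z z' hz hz' he
    have hpΩ : p ∈ Ω.carrier := by
      obtain ⟨r, hr, hr'⟩ := hval z hz
      exact (hr' p).1 hFz ▸ hr
    have hqΩ : q ∈ Ω.carrier := by
      obtain ⟨r, hr, hr'⟩ := hval z' hz'
      exact (hr' q).1 hFz' ▸ hr
    -- An ascent would contradict badness at the final segment from z, whose tail is the final
    -- segment from z'. By totality the sequence descends.
    have hnot : ¬ Ω.le p q := by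
      intro hle
      refine hbad ⟨above X z, h.above_mem hX z, hi.above z, pair i p, pair i q, hFz, ?_, ?_⟩
      · rw [hzz'.tail_above hz]; exact hFz'
      · rcases hi01 with rfl | rfl
        · exact .inl ⟨p, hpΩ, q, hqΩ, hle, rfl⟩
        · exact .inr ⟨p, hpΩ, q, hqΩ, hle, rfl⟩
    refine ⟨(hΩ.total p hpΩ q hqΩ).resolve_left hnot, ?_⟩
    rintro rfl
    exact hnot (hΩ.refl q hqΩ)

theorem exists_firstChange_summand (h : IsModelRCA0 M S) (hA : IsACA S) (hΩ : IsWellOrder S Ω)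
    (hF : IsFunctionTo S (oplus Ω Ω) F) (hbad : IsBad S (oplus Ω Ω) F) {X : Set M} (hX : X ∈ S)
    (hi : IsInf X)
    (hR : Def0 S (fun _ (w : Fin 2 → M) => F (above X (w 0)) (w 1))) :
    ∃ m, FirstChange (Summand F 1) X m := by
  have : Fact (X ∈ S) := ⟨hX⟩
  have hX₀ : above X 0 = X := above_eq_self fun _ _ => zero_le
  have hex : ∃ z, z ∈ X ∧ ¬ (Summand F 1 (above X z) ↔ Summand F 1 X) := by
    by_cases hLX : Summand F 1 X
    · obtain ⟨z, hz, hzL⟩ := exists_not_summand h hA hΩ hF hbad hX hi hR (.inr rfl)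
      exact ⟨z, hz, fun he => hzL (he.2 hLX)⟩
    · obtain ⟨z, hz, hzL⟩ := exists_not_summand h hA hΩ hF hbad hX hi hR (.inl rfl)
      rw [← not_summand_one_iff hF (h.above_mem hX z) (hi.above z), not_not] at hzL
      exact ⟨z, hz, fun he => hLX (he.1 hzL)⟩
  have i₁ := hR.comp₂ (P := fun _ z q => F (above X z) q) h
  -- As a set of the model, the labels of final segments become a parameter, and the least number
  -- principle for bounded formulas applies.
  have : Fact ({z | Summand F 1 (above X z)} ∈ S) :=
    ⟨hA (fun q z => F (above X z) (pair 1 q)) (by infer_instance)⟩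
  obtain ⟨z, hz⟩ := hex
  obtain ⟨m, hm, hmin⟩ := h.least (P := fun z => z ∈ X ∧
    ¬ (z ∈ {z | Summand F 1 (above X z)} ↔ Summand F 1 X)) (by infer_instance) hz
  exact ⟨m, hm.1, hm.2, fun z hzX hzm => by_contra fun hne => hmin z hzm ⟨hzX, hne⟩⟩

/-- The sum of two copies of a well order is `Δ⁰₂`-BQO in a model of arithmetical comprehension in
which the discrete order with three elements is `Δ⁰₂`-BQO. -/
theorem IsACA.isDelta2BQO_oplus (h : IsModelRCA0 M S) (hA : IsACA S)
    (h3 : IsDelta2BQO S (three M)) (hΩ : IsWellOrder S Ω) : IsDelta2BQO S (oplus Ω Ω) := by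
  intro k n θ P v hP hF hbad
  let D : Set M → M → M → M → Prop := fun X y x q => θ.Holds (Matrix.vecCons X P)
    (Matrix.vecCons y (Matrix.vecCons x (Matrix.vecCons q v)))
  have hD : Def0 S (fun X (w : Fin 3 → M) => D X (w 0) (w 1) (w 2)) := θ.def0_holds P v hP
  have i₁ := hD.comp₃ h
  -- The number e codes both the Ω-component of the value and the Σ⁰₂-witness, so that the label has
  -- the form ∃ ∀.
  let E : M → Set M → M → M → Prop := fun i X y e =>
    ∃ x, x < e + 1 ∧ ∃ q, q < e + 1 ∧ e = pair x q ∧ D X y x (pair i q)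
  have hE : ∀ i, Def0 S (fun X (w : Fin 2 → M) => E i X (w 0) (w 1)) := fun i => by
    simp only [E]; infer_instance
  have hEF : ∀ i X, Summand (Sigma2Graph θ P v) i X ↔ ∃ x, ∀ y, E i X y x := by
    intro i X
    constructor
    · rintro ⟨q, x, hx⟩
      exact ⟨pair x q, fun y => ⟨x, Order.lt_add_one_iff.2 (le_pair_left _ _), q,
        Order.lt_add_one_iff.2 (le_pair_right _ _), rfl, hx y⟩⟩
    · rintro ⟨e, he⟩
      obtain ⟨x, -, q, -, rfl, -⟩ := he 0
      refine ⟨q, x, fun y => ?_⟩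
      obtain ⟨x', -, q', -, he', hy⟩ := he y
      obtain ⟨rfl, rfl⟩ := pair_inj.1 he'
      exact hy
  let T : Set M → M → M → Prop := fun X y e =>
    ∃ x, x < e + 1 ∧ ∃ q, q < e + 1 ∧ e = pair x q ∧ D X y x q
  have hT : Def0 S (fun X (w : Fin 2 → M) => T X (w 0) (w 1)) := by
    simp only [T]; infer_instance
  -- For fixed X, two applications of comprehension absorb the two unbounded quantifiers of the
  -- Σ⁰₂-definition of F on final segments.
  have hR : ∀ X, X ∈ S → Def0 S (fun _ (w : Fin 2 → M) =>
      Sigma2Graph θ P v (above X (w 0)) (w 1)) := by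
    intro X hX
    have i₂ : ∀ ⦃n : ℕ⦄ (r s t : (Fin n → M) → M) [IsTerm r] [IsTerm s] [IsTerm t],
        Def0 S (fun _ v => T (above X (r v)) (s v) (t v)) :=
      fun n r s t _ _ _ => (hT.above h r s t).inst hX
    have i₃ := (hA.def0_exists (Q := fun y z e => ¬ T (above X z) y e)
      (fun n r s t _ _ _ => by infer_instance)).comp₂ (P := fun _ z e => ∃ y, ¬ T (above X z) y e) h
    refine (hA.def0_exists (Q := fun x z q => ¬ ∃ y, ¬ T (above X z) y (pair x q))
      (fun n r s t _ _ _ => by infer_instance)).congr fun _ w => exists_congr fun x => ?_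
    rw [not_exists]
    refine forall_congr' fun y => ?_
    rw [not_not]
    constructor
    · rintro ⟨x', -, q', -, he', hy⟩
      obtain ⟨h₁, h₂⟩ := pair_inj.1 he'
      rw [h₁, h₂]
      exact hy
    · exact fun hy => ⟨x, Order.lt_add_one_iff.2 (le_pair_left _ _), _,
        Order.lt_add_one_iff.2 (le_pair_right _ _), rfl, hy⟩
  have hX₀ : ∀ X : Set M, above X 0 = X := fun X => above_eq_self fun _ _ => zero_le
  have hneg : ∀ X, X ∈ S → IsInf X → ∀ z, ¬ Summand (Sigma2Graph θ P v) 1 (above X z) ↔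
      Summand (Sigma2Graph θ P v) 0 (above X z) := fun X hX hi z =>
    not_summand_one_iff hF (h.above_mem hX z) (hi.above z)
  refine not_isDelta2BQO_three h (L := Summand (Sigma2Graph θ P v) 1)
    (def0_changeMatrix h (hE 0) (hE 1)) (def0_changeMatrix h (hE 1) (hE 0)) ?_ ?_
    (fun X hX hi => exists_firstChange_summand h hA hΩ hF hbad hX hi (hR X hX)) h3
  · intro X hX hi m
    rw [changeMatrix_iff h hA (L := fun X => ¬ Summand (Sigma2Graph θ P v) 1 X) (hE 0) (hE 1) hX hi
      (fun z => (hneg X hX hi z).trans (hEF 0 _)) (fun z => not_not.trans (hEF 1 _)) m]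
    unfold FirstChange
    simp only [not_iff_not]
  · intro X hX hi m
    exact changeMatrix_iff h hA (hE 1) (hE 0) hX hi (fun z => hEF 1 _)
      (fun z => (hneg X hX hi z).trans (hEF 0 _)) m

end

end RevMath

/-- Over `RCA₀` (that is, in every model `(M, S)` of this theory): if the discrete order with three
elements is `Δ⁰₂`-BQO, then so is `Ω ⊕ Ω` for every well order `Ω`. -/
theorem mainTheorem8 {M : Type u} [RevMath.L2 M] (S : Set (Set M))
    (hRCA : RevMath.IsModelRCA0 M S)
    (h3 : RevMath.IsDelta2BQO S (RevMath.three M))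
    (Ω : RevMath.CodedOrder M) (hΩ : RevMath.IsWellOrder S Ω) :
    RevMath.IsDelta2BQO S (RevMath.oplus Ω Ω) := by
  have := hRCA.isArith
  exact RevMath.IsACA.isDelta2BQO_oplus hRCA (fun _ hQ => hRCA.sigma1_comprehension h3 hQ) h3 hΩ
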